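/- **Setting.** Let $G$ be a finite graph (loops and multiple edges allowed) with vertex set $V$ and a linearly ordered edge set $E(G)$. For a state $F\subseteq E(G)$, let $B_1,\dots,B_r$ be the connected components of the spanning subgraph $(V,F)$, of sizes $b_1,\dots,b_r$, and put $$\mathcal M_F=\mathrm{Ind}_{\mathfrak S_{B_1}\times\cdots\times\mathfrak S_{B_r}}^{\mathfrak S_V}\bigl(\mathcal L_{b_1}\otimes\cdots\otimes\mathcal L_{b_r}\bigr),\qquad \mathcal L_b=\textstyle\bigwedge^*\mathcal S^{(b-1,1)}\cong\bigoplus_{k=0}^{b-1}\mathcal S^{(b-k,1^k)},$$ a graded $\mathbb C[\mathfrak S_V]$-module; here $\mathcal L_{b_1}\otimes\cdots\otimes\mathcal L_{b_r}=\bigwedge^*\mathcal T_F$ with $\mathcal T_F=\bigoplus_k\mathcal S^{(b_k-1,1)}$ the space of vectors in $\mathbb C^V$ whose coordinates sum to zero over each $B_k$. For $e\in F$ and $F'=F-e$, the per-edge map $d_\varepsilon:\mathcal M_F\to\mathcal M_{F'}$ is the identity if $F$ and $F'$ have the same components; otherwise $\mathcal T_F=\mathcal T_{F'}\oplus\mathbf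 1$ over the Young subgroup of $F'$, and $d_\varepsilon$ is the $\mathfrak S_V$-map corresponding under Frobenius reciprocity to the map $\bigwedge^*\mathcal T_F=\bigwedge^*\mathcal T_{F'}\oplus(\bigwedge^*\mathcal T_{F'})[1]\to\bigwedge^*\mathcal T_{F'}$ that is the identity on the first summand and zero on the second. Let $C_{i,j}(G)=\bigoplus_{|F|=i}(\mathcal M_F)_j$ and $d_{i,j}=\sum_\varepsilon(-1)^{k(\varepsilon)}d_\varepsilon:C_{i,j}(G)\to C_{i-1,j}(G)$, where $k(\varepsilon)$, for $\varepsilon:F\to F-e$, is the number of edges of $G$ after $e$ that are not in $F$. The chromatic symmetric homology of $G$ is $H_{i,j}(G)=\ker d_{i,j}/\operatorname{im}d_{i+1,j}$ and $H_i(G)=\bigoplus_{j\ge0}H_{i,j}(G)$. For a spanning subgraph $A$ of $G$, with the induced order on its edges, $C_*(A)$ is regarded as a subcomplex of $C_*(G)$: each $\mathcal M_F$ is mapped identically to $\mathcal M_F$, up to the sign $\prod_{e\in F}(-1)^{c(e)}$, where $c(e)$ is the number of edges in $E(G)\setminus E(A)$ after $e$, which reconciles the two sign conventions. **Theorem.**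 Let $e_1,e_2,e_3\in E(G)$ form a triangle, and let $A=G-e_1$, $B=G-e_2$, so that $A\cap B=G-e_1-e_2$. Then there is a long exact sequence of graded $\mathfrak S_V$-modules, with degree-preserving maps, $$\cdots\to H_i(A\cap B)\xrightarrow{\ \varphi\ }H_i(A)\oplus H_i(B)\xrightarrow{\ \psi\ }H_i(G)\xrightarrow{\ \delta\ }H_{i-1}(A\cap B)\to\cdots\to H_0(G)\to0,$$ where $\varphi$ and $\psi$ are induced by $x\mapsto(x,-x)$ and $(a,b)\mapsto a+b$ on chains. -/

import Mathlib

open scoped DirectSum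

noncomputable section

namespace ChromSymHom

/-! ## Graphs and states

A finite (multi)graph is given by a finite vertex set `V`, a linearly ordered type `E` of edge
labels, a map `ends : E → Sym2 V` giving the two ends of each edge (loops and multiple edges are
allowed), and the finite set `S : Finset E` of edges which are present. Its states are the spanning
subgraphs `(V, F)` with `F ⊆ S`. Deleting edges from the graph means removing them from `S`; the
remaining edges keep their relative order. -/

section Blocks

variable {V E : Type*} (ends : E → Sym2 V)

/-- `v` and `w` lie in the same connected component of the spanning subgraph `(V, F)`.
(`SimpleGraph.fromEdgeSet` discards loops and multiplicities, which do not affect components.) -/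
def Conn (F : Finset E) (v w : V) : Prop :=
  (SimpleGraph.fromEdgeSet (ends '' (F : Set E))).Reachable v w

theorem Conn.refl (F : Finset E) (v : V) : Conn ends F v v :=
  SimpleGraph.Reachable.refl v

variable {ends} in
theorem Conn.symm {F : Finset E} {v w : V} (h : Conn ends F v w) : Conn ends F w v :=
  SimpleGraph.Reachable.symm h

variable {ends} in
theorem Conn.trans {F : Finset E} {u v w : V} (h : Conn ends F u v) (h' : Conn ends F v w) :
    Conn ends F u w :=
  SimpleGraph.Reachable.trans h h'

variable {ends} in
theorem Conn.mono {F F' : Finset E} (hF : F' ⊆ F) {v w : V} (h : Conn ends F' v w) :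
    Conn ends F v w := by
  refine SimpleGraph.Reachable.mono ?_ h
  exact SimpleGraph.fromEdgeSet_mono (Set.image_mono (by exact_mod_cast hF))

/-- The Young subgroup `𝔖_{B₁} × ⋯ × 𝔖_{Bᵣ}` of `𝔖_V`, where `B₁, …, Bᵣ` are the connected
components of `(V, F)`: the permutations which map every component to itself. -/
def young (F : Finset E) : Subgroup (Equiv.Perm V) where
  carrier := {σ | ∀ v, Conn ends F v (σ v)}
  one_mem' v := Conn.refl ends F v
  mul_mem' {σ τ} hσ hτ v := (hτ v).trans (hσ (τ v))
  inv_mem' {σ} hσ v := by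
    have h := hσ (σ⁻¹ v)
    rw [← Equiv.Perm.mul_apply, mul_inv_cancel, Equiv.Perm.one_apply] at h
    exact h.symm

theorem young_mono {F F' : Finset E} (hF : F' ⊆ F) : young ends F' ≤ young ends F :=
  fun _ hσ v => (hσ v).mono hF

variable [Fintype V]

open scoped Classical in
/-- The vertex set of the connected component of `v` in `(V, F)`. -/
def block (F : Finset E) (v : V) : Finset V := Finset.univ.filter (Conn ends F v)

theorem mem_block {F : Finset E} {v w : V} : w ∈ block ends F v ↔ Conn ends F v w := by
  simp [block]

theorem block_eq {F : Finset E} {v w : V} (h : Conn ends F v w) :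
    block ends F v = block ends F w := by
  ext u
  simp only [mem_block]
  exact ⟨fun h' => h.symm.trans h', fun h' => h.trans h'⟩

theorem card_block_ne_zero (F : Finset E) (v : V) : ((block ends F v).card : ℂ) ≠ 0 := by
  have : v ∈ block ends F v := (mem_block ends).2 (Conn.refl ends F v)
  exact_mod_cast Finset.card_ne_zero_of_mem this

theorem sum_block_perm (F : Finset E) {σ : Equiv.Perm V} (hσ : σ ∈ young ends F) (x : V → ℂ)
    (v : V) : ∑ w ∈ block ends F v, x (σ w) = ∑ w ∈ block ends F v, x w := by
  refine Finset.sum_bij (fun w _ => σ w) ?_ ?_ ?_ ?_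
  · intro w hw
    rw [mem_block] at hw ⊢
    exact hw.trans (hσ w)
  · intro a _ b _ h
    exact σ.injective h
  · intro w hw
    refine ⟨σ⁻¹ w, ?_, by simp⟩
    rw [mem_block] at hw ⊢
    exact hw.trans ((young ends F).inv_mem hσ w)
  · intro _ _
    rfl

end Blocks

/-! ## The graded modules attached to the states -/

section Modules

/-- The permutation representation of `𝔖_V` on `ℂ^V`. -/
def permRep (V : Type*) : Representation ℂ (Equiv.Perm V) (V → ℂ) where
  toFun σ := LinearMap.funLeft ℂ ℂ (σ⁻¹ : Equiv.Perm V)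
  map_one' := by ext; simp
  map_mul' _ _ := by ext; simp [LinearMap.funLeft]

theorem permRep_apply {V : Type*} (σ : Equiv.Perm V) (x : V → ℂ) (v : V) :
    permRep V σ x v = x (σ⁻¹ v) := rfl

/-- The `j`th exterior power of a representation. -/
def extRep {G W : Type*} [Group G] [AddCommGroup W] [Module ℂ W] (ρ : Representation ℂ G W)
    (j : ℕ) : Representation ℂ G (⋀[ℂ]^j W) where
  toFun g := exteriorPower.map j (ρ g)
  map_one' := by rw [map_one]; exact exteriorPower.map_id
  map_mul' g h := by rw [map_mul]; exact exteriorPower.map_comp (ρ h) (ρ g)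

theorem extRep_apply {G W : Type*} [Group G] [AddCommGroup W] [Module ℂ W]
    (ρ : Representation ℂ G W) (j : ℕ) (g : G) : extRep ρ j g = exteriorPower.map j (ρ g) := rfl

/-- For subgroups `H' ≤ H` of `G`, an `H`-module `W` and an `H'`-module `W'`, the `G`-map
`Coind_H W → Coind_{H'} W'` which under Frobenius reciprocity corresponds to the composite of the
evaluation at `1` with the `H'`-map `p : W → W'`. -/
def coindMapOfLE {G W W' : Type*} [Group G] [AddCommGroup W] [Module ℂ W] [AddCommGroup W']
    [Module ℂ W'] {H H' : Subgroup G} (hH : H' ≤ H) (ρ : Representation ℂ H W)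
    (ρ' : Representation ℂ H' W') (p : W →ₗ[ℂ] W')
    (hp : ∀ (h : H') (w : W), p (ρ ⟨h, hH h.2⟩ w) = ρ' h (p w)) :
    (Representation.coind H.subtype ρ).IntertwiningMap (Representation.coind H'.subtype ρ') where
  toLinearMap := (p.compLeft G).restrict <| by
    intro f hf h g
    have h1 := hf ⟨h, hH h.2⟩ g
    change f (h * g) = _ at h1
    change p (f (h * g)) = ρ' h (p (f g))
    rw [h1, hp]
  isIntertwining' _ := rfl

variable {V E : Type*} [Fintype V] (ends : E → Sym2 V)

/-- The space `𝒯_F = ⨁ₖ 𝒮^{(bₖ - 1, 1)}`, where `bₖ` are the sizes of the components of `(V, F)`: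
the vectors of `ℂ^V` whose coordinates sum to zero over each component. -/
def stdSpace (F : Finset E) : Submodule ℂ (V → ℂ) where
  carrier := {x | ∀ v, ∑ w ∈ block ends F v, x w = 0}
  zero_mem' v := by simp
  add_mem' {x y} hx hy v := by
    simp only [Pi.add_apply, Finset.sum_add_distrib]
    rw [hx v, hy v, add_zero]
  smul_mem' c x hx v := by
    simp only [Pi.smul_apply, ← Finset.smul_sum]
    rw [hx v, smul_zero]

/-- The action of the Young subgroup of `F` on `𝒯_F`. -/
def stdRep (F : Finset E) : Representation ℂ (young ends F) (stdSpace ends F) :=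
  Representation.subrepresentation ((permRep V).comp (young ends F).subtype) (stdSpace ends F) <| by
    intro σ x hx v
    exact (sum_block_perm ends F (σ⁻¹).2 x v).trans (hx v)

/-- The underlying space of `(ℳ_F)_j`. -/
def StateMod (F : Finset E) (j : ℕ) : Type _ :=
  Representation.coindV (young ends F).subtype (extRep (stdRep ends F) j)

instance (F : Finset E) (j : ℕ) : AddCommGroup (StateMod ends F j) :=
  inferInstanceAs (AddCommGroup
    (Representation.coindV (young ends F).subtype (extRep (stdRep ends F) j)))

instance (F : Finset E) (j : ℕ) : Module ℂ (StateMod ends F j) :=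
  inferInstanceAs (Module ℂ
    (Representation.coindV (young ends F).subtype (extRep (stdRep ends F) j)))

/-- The degree `j` part `(ℳ_F)_j` of the graded `𝔖_V`-module
`ℳ_F = Ind_{𝔖_{B₁} × ⋯ × 𝔖_{Bᵣ}}^{𝔖_V} (ℒ_{b₁} ⊗ ⋯ ⊗ ℒ_{bᵣ})`, where
`ℒ_b = ⋀^* 𝒮^{(b-1,1)}`, so that `ℒ_{b₁} ⊗ ⋯ ⊗ ℒ_{bᵣ} = ⋀^* 𝒯_F`.
The induced module is realized as the module of functions `f : 𝔖_V → ⋀^j 𝒯_F` with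
`f (h g) = h f(g)` for `h` in the Young subgroup (for finite groups, induction and coinduction
agree); this is the form in which Frobenius reciprocity `Hom(M, Ind W) = Hom(Res M, W)` holds. -/
def stateRep (F : Finset E) (j : ℕ) : Representation ℂ (Equiv.Perm V) (StateMod ends F j) :=
  Representation.coind (young ends F).subtype (extRep (stdRep ends F) j)

/-- The projection `ℂ^V → 𝒯_F` which subtracts from each coordinate the mean over its component:
it is the identity on `𝒯_F` and zero on the vectors that are constant on each component. -/
def proj (F : Finset E) : (V → ℂ) →ₗ[ℂ] stdSpace ends F where
  toFun x := ⟨fun v => x v - (∑ w ∈ block ends F v, x w) / (block ends F v).card, by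
    intro v
    rw [Finset.sum_sub_distrib, sub_eq_zero]
    have h : ∀ w ∈ block ends F v,
        (∑ u ∈ block ends F w, x u) / ((block ends F w).card : ℂ) =
          (∑ u ∈ block ends F v, x u) / ((block ends F v).card : ℂ) := by
      intro w hw
      rw [block_eq ends ((mem_block ends).1 hw)]
    rw [Finset.sum_congr rfl h, Finset.sum_const, nsmul_eq_mul,
      mul_div_cancel₀ _ (card_block_ne_zero ends F v)]⟩
  map_add' x y := by
    ext v
    simp only [Pi.add_apply, Finset.sum_add_distrib, Submodule.coe_add]
    ring
  map_smul' c x := by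
    ext v
    simp only [Pi.smul_apply, smul_eq_mul, ← Finset.mul_sum, RingHom.id_apply,
      Submodule.coe_smul]
    ring

theorem proj_coe (F : Finset E) (x : V → ℂ) (v : V) :
    (proj ends F x : V → ℂ) v = x v - (∑ w ∈ block ends F v, x w) / (block ends F v).card := rfl

/-- The map `𝒯_F → 𝒯_{F'}`. For `F' = F - e ⊆ F`, one has `𝒯_F = 𝒯_{F'}` if deleting `e` does not
disconnect a component of `F`, and otherwise `Res 𝒯_F = 𝒯_{F'} ⊕ 𝟏` as a representation of the
Young subgroup of `F'`; the map is the identity on `𝒯_{F'}` and zero on the trivial summand. -/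
def stdMap (F F' : Finset E) : stdSpace ends F →ₗ[ℂ] stdSpace ends F' :=
  proj ends F' ∘ₗ (stdSpace ends F).subtype

theorem stdMap_equivariant {F F' : Finset E} (hF : F' ⊆ F) (σ : young ends F') :
    stdMap ends F F' ∘ₗ stdRep ends F ⟨σ, young_mono ends hF σ.2⟩ =
      stdRep ends F' σ ∘ₗ stdMap ends F F' := by
  refine LinearMap.ext fun x => Subtype.ext (funext fun v => ?_)
  have hσ : (σ : Equiv.Perm V)⁻¹ ∈ young ends F' := (σ⁻¹).2
  change (x : V → ℂ) ((σ : Equiv.Perm V)⁻¹ v) -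
      (∑ w ∈ block ends F' v, (x : V → ℂ) ((σ : Equiv.Perm V)⁻¹ w)) / (block ends F' v).card =
    (x : V → ℂ) ((σ : Equiv.Perm V)⁻¹ v) -
      (∑ w ∈ block ends F' ((σ : Equiv.Perm V)⁻¹ v), (x : V → ℂ) w) /
        (block ends F' ((σ : Equiv.Perm V)⁻¹ v)).card
  rw [sum_block_perm ends F' hσ, ← block_eq ends (hσ v)]

theorem extMap_equivariant {F F' : Finset E} (hF : F' ⊆ F) (j : ℕ) (σ : young ends F')
    (w : ⋀[ℂ]^j (stdSpace ends F)) :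
    exteriorPower.map j (stdMap ends F F')
        (extRep (stdRep ends F) j ⟨σ, young_mono ends hF σ.2⟩ w) =
      extRep (stdRep ends F') j σ (exteriorPower.map j (stdMap ends F F') w) := by
  rw [extRep_apply, extRep_apply, ← LinearMap.comp_apply, ← LinearMap.comp_apply,
    ← exteriorPower.map_comp, ← exteriorPower.map_comp, stdMap_equivariant ends hF]

/-- The (unsigned) per-edge map `d_ε : ℳ_F → ℳ_{F'}` in degree `j`, for `F' = F - e`. It is the
`𝔖_V`-map which under Frobenius reciprocity corresponds to the map
`⋀^* (𝒯_F → 𝒯_{F'}) : ⋀^* 𝒯_F → ⋀^* 𝒯_{F'}` of modules over the Young subgroup of `F'`, i.e. to the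
identity if `𝒯_F = 𝒯_{F'}`, and otherwise to the map which is the identity on `⋀^* 𝒯_{F'}` and zero
on `(⋀^* 𝒯_{F'})[1]` in `Res (⋀^* 𝒯_F) = ⋀^* 𝒯_{F'} ⊕ (⋀^* 𝒯_{F'})[1]`. -/
def edgeMap {F F' : Finset E} (hF : F' ⊆ F) (j : ℕ) :
    (stateRep ends F j).IntertwiningMap (stateRep ends F' j) :=
  coindMapOfLE (young_mono ends hF) (extRep (stdRep ends F) j) (extRep (stdRep ends F') j)
    (exteriorPower.map j (stdMap ends F F')) (extMap_equivariant ends hF j)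

theorem edgeMap_apply {F F' : Finset E} (hF : F' ⊆ F) (j : ℕ) (f : StateMod ends F j)
    (τ : Equiv.Perm V) :
    (edgeMap ends hF j f).1 τ = exteriorPower.map j (stdMap ends F F') (f.1 τ) := rfl

theorem proj_proj {F F' : Finset E} (hF : F' ⊆ F) (x : V → ℂ) :
    proj ends F' (proj ends F x : V → ℂ) = proj ends F' x := by
  refine Subtype.ext (funext fun v => ?_)
  have h : ∀ w ∈ block ends F' v,
      (∑ u ∈ block ends F w, x u) / ((block ends F w).card : ℂ) =
        (∑ u ∈ block ends F v, x u) / ((block ends F v).card : ℂ) := by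
    intro w hw
    rw [block_eq ends (((mem_block ends).1 hw).mono hF)]
  simp only [proj_coe, Finset.sum_sub_distrib]
  rw [Finset.sum_congr rfl h, Finset.sum_const, nsmul_eq_mul, sub_div,
    mul_div_cancel_left₀ _ (card_block_ne_zero ends F' v)]
  ring

theorem edgeMap_comp {F F' F'' : Finset E} (hF : F' ⊆ F) (hF' : F'' ⊆ F') (j : ℕ)
    (f : StateMod ends F j) :
    edgeMap ends hF' j (edgeMap ends hF j f) = edgeMap ends (hF'.trans hF) j f := by
  refine Subtype.ext (funext fun τ => ?_)
  rw [edgeMap_apply, edgeMap_apply, edgeMap_apply, ← LinearMap.comp_apply, ← exteriorPower.map_comp]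
  congr 2
  exact LinearMap.ext fun x => proj_proj ends hF' _

end Modules

/-! ## The chain complex -/

section Complex

variable {V E : Type*} [Fintype V] [LinearOrder E] (ends : E → Sym2 V)

/-- The states with exactly `i` edges of the graph with edge set `S`. -/
abbrev State (S : Finset E) (i : ℕ) : Type _ := {F : Finset E // F ⊆ S ∧ F.card = i}

/-- The underlying space of `C_{i,j}`. -/
abbrev ChainMod (S : Finset E) (i j : ℕ) : Type _ := ⨁ F : State S i, StateMod ends F.1 j

/-- The chain module `C_{i,j} = ⨁_{|F| = i} (ℳ_F)_j` of the graph with edge set `S`. -/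
def chainRep (S : Finset E) (i j : ℕ) : Representation ℂ (Equiv.Perm V) (ChainMod ends S i j) :=
  Representation.directSum fun F : State S i => stateRep ends F.1 j

/-- The inclusion of the summand `(ℳ_F)_j` in `C_{i,j}`. -/
def summand {S : Finset E} {i : ℕ} (F : Finset E) (hF : F ⊆ S ∧ F.card = i) (j : ℕ) :
    StateMod ends F j →ₗ[ℂ] ChainMod ends S i j :=
  DirectSum.lof ℂ (State S i) (fun F => StateMod ends F.1 j) ⟨F, hF⟩

theorem erase_state {S F : Finset E} {i : ℕ} (hF : F ⊆ S ∧ F.card = i + 1) {e : E} (he : e ∈ F) :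
    F.erase e ⊆ S ∧ (F.erase e).card = i :=
  ⟨(Finset.erase_subset _ _).trans hF.1, by
    rw [Finset.card_erase_of_mem he, hF.2, Nat.add_sub_cancel]⟩

/-- The sign `(-1)^k` of the edge `F → F - e` of the Hasse diagram, where `k` is the number of ones
after the entry `*` in its binary string, that is, the number of edges `f` of the graph which come
after `e` and do not belong to the state `F`. -/
def edgeSign (S F : Finset E) (e : E) : ℂ :=
  (-1) ^ (S.filter fun f => f ∉ F ∧ e < f).card

/-- The differential `d_{i+1,j} = ∑_ε sgn(ε) d_ε : C_{i+1,j} → C_{i,j}` as a linear map. -/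
def diffLin (S : Finset E) (i j : ℕ) : ChainMod ends S (i + 1) j →ₗ[ℂ] ChainMod ends S i j :=
  DirectSum.toModule ℂ (State S (i + 1)) _ fun F =>
    ∑ e : F.1, edgeSign S F.1 e •
      (summand ends (F.1.erase e) (erase_state F.2 e.2) j ∘ₗ
        (edgeMap ends (Finset.erase_subset e.1 F.1) j).toLinearMap)

theorem diffLin_summand {S : Finset E} {i : ℕ} (F : Finset E) (hF : F ⊆ S ∧ F.card = i + 1) (j : ℕ)
    (x : StateMod ends F j) :
    diffLin ends S i j (summand ends F hF j x) =
      ∑ e : F, edgeSign S F e • summand ends (F.erase e) (erase_state hF e.2) j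
        (edgeMap ends (Finset.erase_subset e.1 F) j x) := by
  rw [diffLin, summand, DirectSum.toModule_lof, LinearMap.sum_apply]
  rfl

theorem chainRep_summand {S : Finset E} {i : ℕ} (j : ℕ) (σ : Equiv.Perm V) (F : Finset E)
    (hF : F ⊆ S ∧ F.card = i) (x : StateMod ends F j) :
    chainRep ends S i j σ (summand ends F hF j x) =
      summand ends F hF j (stateRep ends F j σ x) :=
  DirectSum.lmap_lof _ _ _

variable {ends} in
theorem chain_ext {S : Finset E} {i j : ℕ} {W : Type*} [AddCommMonoid W] [Module ℂ W]
    {f g : ChainMod ends S i j →ₗ[ℂ] W}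
    (h : ∀ F hF x, f (summand ends F hF j x) = g (summand ends F hF j x)) : f = g :=
  DirectSum.linearMap_ext ℂ fun F => LinearMap.ext (h F.1 F.2)

/-- The differential `d_{i+1,j} : C_{i+1,j} → C_{i,j}` as a map of `𝔖_V`-modules. -/
def diff (S : Finset E) (i j : ℕ) :
    (chainRep ends S (i + 1) j).IntertwiningMap (chainRep ends S i j) where
  toLinearMap := diffLin ends S i j
  isIntertwining' σ := by
    refine chain_ext fun F hF x => ?_
    rw [LinearMap.comp_apply, LinearMap.comp_apply, chainRep_summand, diffLin_summand,
      diffLin_summand, map_sum]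
    refine Finset.sum_congr rfl fun e _ => ?_
    rw [map_smul, chainRep_summand, Representation.IntertwiningMap.isIntertwining]

theorem edgeSign_erase {S F : Finset E} {e f : E} (heS : e ∈ S) (he : e ∈ F) :
    edgeSign S (F.erase e) f = if f < e then -edgeSign S F f else edgeSign S F f := by
  unfold edgeSign
  split_ifs with h
  · have h1 : (S.filter fun g => g ∉ F.erase e ∧ f < g) =
        insert e (S.filter fun g => g ∉ F ∧ f < g) := by
      ext g
      by_cases hg : g = e
      · subst hg
        simp [heS, h]
      · simp [hg]
    rw [h1, Finset.card_insert_of_notMem (by simp [he]), pow_succ, mul_neg_one]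
  · have h1 : (S.filter fun g => g ∉ F.erase e ∧ f < g) = S.filter fun g => g ∉ F ∧ f < g := by
      ext g
      by_cases hg : g = e
      · subst hg
        simp [h]
      · simp [hg]
    rw [h1]

theorem edgeSign_square {S F : Finset E} (hF : F ⊆ S) {e f : E} (he : e ∈ F) (hf : f ∈ F)
    (hef : e ≠ f) :
    edgeSign S F e * edgeSign S (F.erase e) f = -(edgeSign S F f * edgeSign S (F.erase f) e) := by
  rw [edgeSign_erase (hF he) he, edgeSign_erase (hF hf) hf]
  rcases lt_or_gt_of_ne hef with h | h
  · rw [if_neg h.not_gt, if_pos h]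
    ring
  · rw [if_pos h, if_neg h.not_gt]
    ring

theorem summand_edgeMap_congr {S : Finset E} {i : ℕ} {F₀ F F' : Finset E} (h : F = F')
    (hF : F ⊆ S ∧ F.card = i) (hF' : F' ⊆ S ∧ F'.card = i) (h1 : F ⊆ F₀) (h2 : F' ⊆ F₀) (j : ℕ)
    (x : StateMod ends F₀ j) :
    summand ends F hF j (edgeMap ends h1 j x) = summand ends F' hF' j (edgeMap ends h2 j x) := by
  subst h
  rfl

/-- The differential squares to zero. -/
theorem diffLin_diffLin (S : Finset E) (i j : ℕ) :
    diffLin ends S i j ∘ₗ diffLin ends S (i + 1) j = 0 := by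
  refine chain_ext fun F hF x => ?_
  rw [LinearMap.comp_apply, LinearMap.zero_apply, diffLin_summand, map_sum]
  simp only [map_smul, diffLin_summand, Finset.smul_sum, smul_smul, edgeMap_comp]
  rw [Finset.sum_sigma']
  refine Finset.sum_involution
    (fun p _ => ⟨⟨p.2.1, Finset.mem_of_mem_erase p.2.2⟩,
      ⟨p.1.1, Finset.mem_erase.2 ⟨fun h => Finset.ne_of_mem_erase p.2.2 h.symm, p.1.2⟩⟩⟩)
    ?_ ?_ ?_ ?_
  · rintro ⟨⟨e, he⟩, ⟨f, hf⟩⟩ _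
    have hne : e ≠ f := fun h => Finset.ne_of_mem_erase hf h.symm
    have hf' : f ∈ F := Finset.mem_of_mem_erase hf
    have he' : e ∈ F.erase f := Finset.mem_erase.2 ⟨hne, he⟩
    have h2 := summand_edgeMap_congr ends (Finset.erase_right_comm : (F.erase e).erase f = _)
      (erase_state (erase_state hF he) hf) (erase_state (erase_state hF hf') he')
      ((Finset.erase_subset _ _).trans (Finset.erase_subset _ _))
      ((Finset.erase_subset _ _).trans (Finset.erase_subset _ _)) j x
    have h3 := edgeSign_square hF.1 he hf' hne
    dsimp only
    rw [h2, h3, ← add_smul, neg_add_cancel, zero_smul]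
  · rintro ⟨⟨e, he⟩, ⟨f, hf⟩⟩ _ _ h
    have h1 : f = e := congrArg (fun p : (a : F) × (F.erase a.1 : Finset E) => p.1.1) h
    exact Finset.ne_of_mem_erase hf h1
  · intro _ _
    simp
  · intro _ _
    rfl

/-! ### Functoriality for spanning subgraphs -/

/-- The sign by which the inclusion of the chain complex of a spanning subgraph with edge set `S`
into that of the graph with edge set `S'` has to be corrected on the summand `ℳ_F`: the sign of the
per-edge map `F → F - e` depends on the number of absent edges after `e`, and the edges in `S' \ S`
are counted in the larger graph but not in the smaller one. -/
def inclSign (S S' F : Finset E) : ℂ :=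
  ∏ e ∈ F, (-1) ^ ((S' \ S).filter fun f => e < f).card

theorem inclSign_mul_edgeSign {S S' F : Finset E} (hS : S ⊆ S') (hF : F ⊆ S) {e : E}
    (he : e ∈ F) :
    inclSign S S' F * edgeSign S' F e = edgeSign S F e * inclSign S S' (F.erase e) := by
  have h1 : edgeSign S' F e =
      edgeSign S F e * (-1) ^ ((S' \ S).filter fun f => e < f).card := by
    unfold edgeSign
    rw [← pow_add, ← Finset.card_union_of_disjoint]
    · congr 2
      ext g
      simp only [Finset.mem_filter, Finset.mem_union, Finset.mem_sdiff]
      constructor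
      · rintro ⟨a, b, c⟩
        by_cases hg : g ∈ S
        · exact Or.inl ⟨hg, b, c⟩
        · exact Or.inr ⟨⟨a, hg⟩, c⟩
      · rintro (⟨a, b, c⟩ | ⟨⟨a, b⟩, c⟩)
        · exact ⟨hS a, b, c⟩
        · exact ⟨a, fun h => b (hF h), c⟩
    · rw [Finset.disjoint_left]
      intro g hg hg'
      simp only [Finset.mem_filter, Finset.mem_sdiff] at hg hg'
      exact hg'.1.2 hg.1
  have h2 : inclSign S S' F =
      (-1) ^ ((S' \ S).filter fun f => e < f).card * inclSign S S' (F.erase e) :=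
    (Finset.mul_prod_erase F _ he).symm
  rw [h1, h2]
  have h3 : ((-1 : ℂ) ^ ((S' \ S).filter fun f => e < f).card) *
      (-1) ^ ((S' \ S).filter fun f => e < f).card = 1 := by
    rw [← mul_pow]
    simp
  linear_combination (edgeSign S F e * inclSign S S' (F.erase e)) * h3

/-- The inclusion `C_{i,j}(V, S) ⊆ C_{i,j}(V, S')` for `S ⊆ S'` as a linear map: it maps the summand
of the state `F` to the summand of the same state `F`, by the identity up to sign. -/
def inclLin {S S' : Finset E} (hS : S ⊆ S') (i j : ℕ) :
    ChainMod ends S i j →ₗ[ℂ] ChainMod ends S' i j :=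
  DirectSum.toModule ℂ (State S i) _ fun F =>
    inclSign S S' F.1 • summand ends F.1 ⟨F.2.1.trans hS, F.2.2⟩ j

theorem inclLin_summand {S S' : Finset E} (hS : S ⊆ S') {i : ℕ} (F : Finset E)
    (hF : F ⊆ S ∧ F.card = i) (j : ℕ) (x : StateMod ends F j) :
    inclLin ends hS i j (summand ends F hF j x) =
      inclSign S S' F • summand ends F ⟨hF.1.trans hS, hF.2⟩ j x := by
  rw [inclLin, summand, DirectSum.toModule_lof, LinearMap.smul_apply]

theorem inclLin_equivariant {S S' : Finset E} (hS : S ⊆ S') (i j : ℕ) (σ : Equiv.Perm V) :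
    inclLin ends hS i j ∘ₗ chainRep ends S i j σ =
      chainRep ends S' i j σ ∘ₗ inclLin ends hS i j := by
  refine chain_ext fun F hF x => ?_
  rw [LinearMap.comp_apply, LinearMap.comp_apply, chainRep_summand, inclLin_summand,
    inclLin_summand, map_smul, chainRep_summand]

/-- The inclusion is a chain map. -/
theorem inclLin_diffLin {S S' : Finset E} (hS : S ⊆ S') (i j : ℕ) :
    inclLin ends hS i j ∘ₗ diffLin ends S i j =
      diffLin ends S' i j ∘ₗ inclLin ends hS (i + 1) j := by
  refine chain_ext fun F hF x => ?_
  rw [LinearMap.comp_apply, LinearMap.comp_apply, diffLin_summand, inclLin_summand, map_smul,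
    map_sum, diffLin_summand, Finset.smul_sum]
  refine Finset.sum_congr rfl fun e _ => ?_
  rw [map_smul, inclLin_summand, smul_smul, smul_smul, inclSign_mul_edgeSign hS hF.1 e.2]

/-! ## Homology -/

/-- The cycles `ker d_{i,j} ⊆ C_{i,j}`, where `d_{0,j} = 0`. -/
def cycles (S : Finset E) : (i j : ℕ) → Submodule ℂ (ChainMod ends S i j)
  | 0, _ => ⊤
  | i + 1, j => LinearMap.ker (diffLin ends S i j)

/-- The boundaries `im d_{i+1,j} ⊆ C_{i,j}`. -/
def boundaries (S : Finset E) (i j : ℕ) : Submodule ℂ (ChainMod ends S i j) :=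
  LinearMap.range (diffLin ends S i j)

theorem boundaries_le_cycles (S : Finset E) (i j : ℕ) :
    boundaries ends S i j ≤ cycles ends S i j := by
  cases i with
  | zero => exact le_top
  | succ i =>
    rintro _ ⟨x, rfl⟩
    exact LinearMap.congr_fun (diffLin_diffLin ends S i j) x

theorem cycles_le_comap (S : Finset E) (i j : ℕ) (σ : Equiv.Perm V) :
    cycles ends S i j ≤ (cycles ends S i j).comap (chainRep ends S i j σ) := by
  cases i with
  | zero => exact le_top
  | succ i =>
    intro x hx
    change diffLin ends S i j x = 0 at hx
    change diffLin ends S i j (chainRep ends S (i + 1) j σ x) = 0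
    have h := LinearMap.congr_fun ((diff ends S i j).isIntertwining' σ) x
    change diffLin ends S i j (chainRep ends S (i + 1) j σ x) =
      chainRep ends S i j σ (diffLin ends S i j x) at h
    rw [h, hx, map_zero]

theorem boundaries_le_comap (S : Finset E) (i j : ℕ) (σ : Equiv.Perm V) :
    boundaries ends S i j ≤ (boundaries ends S i j).comap (chainRep ends S i j σ) := by
  rintro _ ⟨x, rfl⟩
  exact ⟨chainRep ends S (i + 1) j σ x, LinearMap.congr_fun ((diff ends S i j).isIntertwining' σ) x⟩

/-- The bigraded homology `H_{i,j} = ker d_{i,j} / im d_{i+1,j}` of the graph with edge set `S`. -/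
def BiHomology (S : Finset E) (i j : ℕ) : Type _ :=
  cycles ends S i j ⧸ (boundaries ends S i j).submoduleOf (cycles ends S i j)

instance (S : Finset E) (i j : ℕ) : AddCommGroup (BiHomology ends S i j) :=
  inferInstanceAs (AddCommGroup
    (cycles ends S i j ⧸ (boundaries ends S i j).submoduleOf (cycles ends S i j)))

instance (S : Finset E) (i j : ℕ) : Module ℂ (BiHomology ends S i j) :=
  inferInstanceAs (Module ℂ
    (cycles ends S i j ⧸ (boundaries ends S i j).submoduleOf (cycles ends S i j)))

/-- The action of `𝔖_V` on `H_{i,j}`. -/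
def biHomologyRep (S : Finset E) (i j : ℕ) :
    Representation ℂ (Equiv.Perm V) (BiHomology ends S i j) :=
  Representation.quotient
    (Representation.subrepresentation (chainRep ends S i j) (cycles ends S i j)
      (cycles_le_comap ends S i j))
    ((boundaries ends S i j).submoduleOf (cycles ends S i j))
    fun σ _ hx => boundaries_le_comap ends S i j σ hx

theorem inclLin_cycles {S S' : Finset E} (hS : S ⊆ S') (i j : ℕ) (x : ChainMod ends S i j)
    (hx : x ∈ cycles ends S i j) : inclLin ends hS i j x ∈ cycles ends S' i j := by
  cases i with
  | zero => exact Submodule.mem_top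
  | succ i =>
    change diffLin ends S i j x = 0 at hx
    change diffLin ends S' i j (inclLin ends hS (i + 1) j x) = 0
    rw [← LinearMap.comp_apply, ← inclLin_diffLin, LinearMap.comp_apply, hx, map_zero]

theorem inclLin_boundaries {S S' : Finset E} (hS : S ⊆ S') (i j : ℕ) (x : ChainMod ends S i j)
    (hx : x ∈ boundaries ends S i j) : inclLin ends hS i j x ∈ boundaries ends S' i j := by
  obtain ⟨y, rfl⟩ := hx
  exact ⟨inclLin ends hS (i + 1) j y, (LinearMap.congr_fun (inclLin_diffLin ends hS i j) y).symm⟩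

/-- The map `H_{i,j}(V, S) → H_{i,j}(V, S')` induced by the inclusion of chain complexes, for
`S ⊆ S'`. -/
def biHomologyMap {S S' : Finset E} (hS : S ⊆ S') (i j : ℕ) :
    (biHomologyRep ends S i j).IntertwiningMap (biHomologyRep ends S' i j) where
  toLinearMap := Submodule.mapQ _ _
    ((inclLin ends hS i j).restrict (inclLin_cycles ends hS i j))
    fun x hx => inclLin_boundaries ends hS i j x hx
  isIntertwining' σ := by
    refine LinearMap.ext fun x => ?_
    obtain ⟨x, rfl⟩ := Submodule.Quotient.mk_surjective _ x
    refine congrArg (Submodule.Quotient.mk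
      (p := (boundaries ends S' i j).submoduleOf (cycles ends S' i j))) (Subtype.ext ?_)
    exact LinearMap.congr_fun (inclLin_equivariant ends hS i j σ) x

/-- A family of maps of `G`-modules `X_j → Y_j` induces a (degree-preserving) map of `G`-modules
`⨁_j X_j → ⨁_j Y_j`. -/
def gradedMap {G : Type*} [Group G] {X Y : ℕ → Type*} [∀ j, AddCommGroup (X j)]
    [∀ j, Module ℂ (X j)] [∀ j, AddCommGroup (Y j)] [∀ j, Module ℂ (Y j)]
    {ρ : ∀ j, Representation ℂ G (X j)} {τ : ∀ j, Representation ℂ G (Y j)}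
    (f : ∀ j, (ρ j).IntertwiningMap (τ j)) :
    (Representation.directSum ρ).IntertwiningMap (Representation.directSum τ) where
  toLinearMap := DirectSum.lmap fun j => (f j).toLinearMap
  isIntertwining' g := by
    refine LinearMap.ext fun x => DFinsupp.ext fun j => ?_
    exact LinearMap.congr_fun ((f j).isIntertwining' g) (x j)

/-- The chromatic symmetric homology `H_i = ⨁_j H_{i,j}` of the graph with edge set `S`. -/
abbrev Homology (S : Finset E) (i : ℕ) : Type _ := ⨁ j : ℕ, BiHomology ends S i j

/-- The action of `𝔖_V` on `H_i`. -/
def homologyRep (S : Finset E) (i : ℕ) :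
    Representation ℂ (Equiv.Perm V) (Homology ends S i) :=
  Representation.directSum fun j => biHomologyRep ends S i j

/-- The map `H_i(V, S) → H_i(V, S')` induced by the inclusion of chain complexes, for `S ⊆ S'`. -/
def homologyMap {S S' : Finset E} (hS : S ⊆ S') (i : ℕ) :
    (homologyRep ends S i).IntertwiningMap (homologyRep ends S' i) :=
  gradedMap fun j => biHomologyMap ends hS i j

/-- The map `φ : H_i(A ∩ B) → H_i(A) ⊕ H_i(B)` induced by `x ↦ (x, -x)`, for spanning subgraphs with
edge sets `A` and `B`. -/
def mvPhi (A B : Finset E) (i : ℕ) :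
    (homologyRep ends (A ∩ B) i).IntertwiningMap
      ((homologyRep ends A i).prod (homologyRep ends B i)) :=
  Representation.IntertwiningMap.prod (homologyMap ends Finset.inter_subset_left i)
    (-homologyMap ends Finset.inter_subset_right i)

/-- The map `ψ : H_i(A) ⊕ H_i(B) → H_i(G)` induced by `(a, b) ↦ a + b`, for spanning subgraphs with
edge sets `A` and `B` of the graph with edge set `S`. -/
def mvPsi {A B S : Finset E} (hA : A ⊆ S) (hB : B ⊆ S) (i : ℕ) :
    ((homologyRep ends A i).prod (homologyRep ends B i)).IntertwiningMap
      (homologyRep ends S i) :=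
  (homologyMap ends hA i).comp (Representation.IntertwiningMap.fst ℂ _ _) +
    (homologyMap ends hB i).comp (Representation.IntertwiningMap.snd ℂ _ _)

end Complex

end ChromSymHom

end

/-! Inside `C(G)`, the sum `C(A) + C(B)` consists of the summands of the states that do not contain
both `e₁` and `e₂`, and `C(A) ∩ C(B)` is `C(A ∩ B)`. The short exact sequence `0 → C(A ∩ B) → C(A) ⊕
C(B) → C(A) + C(B) → 0` would give the result at once if `C(A) + C(B)` had the homology of `C(G)`.
This is where the triangle enters. The states outside the sum contain `e₁` and `e₂`, and these
already connect the ends of `e₃`. Such states therefore come in pairs `F`, `F + e₃` with the same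
components, the per-edge map between the two is an isomorphism, and the quotient `C(G) / (C(A) +
C(B))` is acyclic.

The acyclicity is made explicit by the homotopy `h` (`fillLin`), which inserts `e₃` by inverting
that isomorphism. The map `p = 1 - dh - hd` (`pushLin`) takes values in `C(A) + C(B)`
(`pushLin_mem_sumChains`), fixes the chains of `A` and of `B` (`pushLin_inclLin`), and moves a cycle
only by a boundary.

For a cycle `x`, write `p x = a + b` with `a` in `C(A)` and `b` in `C(B)`. Then `da = -db` lies in
`C(A ∩ B)`, and its class is `δ[x]`. The part `a` is cut out by an equivariant retraction, so `δ`
comes from an equivariant linear map of chains (`snakeLin`); `snakeLin_spec` and `snakeLin_unique`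
reduce each exactness statement to a short diagram chase. -/

open scoped DirectSum

noncomputable section

namespace ChromSymHom

/-! ### Maps between state modules along refinements of components. -/

section Transfer

variable {V E : Type*} (ends : E → Sym2 V)

/-- The components of `(V, F')` refine those of `(V, F)`. -/
def Refines (F' F : Finset E) : Prop := ∀ v w, Conn ends F' v w → Conn ends F v w

variable {ends}

theorem Refines.of_subset {F' F : Finset E} (h : F' ⊆ F) : Refines ends F' F :=
  fun _ _ hc => hc.mono h

theorem Refines.trans {F'' F' F : Finset E} (h' : Refines ends F'' F') (h : Refines ends F' F) :
    Refines ends F'' F :=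
  fun v w hc => h v w (h' v w hc)

theorem Refines.young_le {F' F : Finset E} (h : Refines ends F' F) :
    young ends F' ≤ young ends F :=
  fun _ hσ v => h _ _ (hσ v)

/-- Adding an edge whose ends are already connected does not change the components. -/
theorem refines_insert [DecidableEq E] {F : Finset E} {e : E} {u w : V} (he : ends e = s(u, w))
    (huw : Conn ends F u w) : Refines ends (insert e F) F := by
  rintro v v' ⟨p⟩
  induction p with
  | nil => exact Conn.refl ends F _
  | @cons a b c hab _ ih =>
    refine Conn.trans ?_ ih
    rw [SimpleGraph.fromEdgeSet_adj] at hab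
    obtain ⟨⟨f, hf, hfe⟩, hne⟩ := hab
    rw [Finset.mem_coe, Finset.mem_insert] at hf
    rcases hf with rfl | hf
    · rw [he, Sym2.eq_iff] at hfe
      rcases hfe with ⟨rfl, rfl⟩ | ⟨rfl, rfl⟩
      · exact huw
      · exact huw.symm
    · refine SimpleGraph.Adj.reachable ?_
      rw [SimpleGraph.fromEdgeSet_adj]
      exact ⟨⟨f, hf, hfe⟩, hne⟩

theorem conn_of_mem {F : Finset E} {e : E} (he : e ∈ F) {u v : V} (h : ends e = s(u, v))
    (huv : u ≠ v) : Conn ends F u v := by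
  refine SimpleGraph.Adj.reachable ?_
  rw [SimpleGraph.fromEdgeSet_adj]
  exact ⟨⟨e, he, h⟩, huv⟩

variable [Fintype V]

/-- Each component of `F'` lies in one component of `F`, so the means subtracted first are constant
on the components of `F'` and are killed by the second projection. Only refinement of components
matters, not containment of edge sets; this freedom is what allows maps that add an edge. -/
theorem Refines.proj_proj {F F' : Finset E} (hF : Refines ends F' F) (x : V → ℂ) :
    proj ends F' (proj ends F x : V → ℂ) = proj ends F' x := by
  refine Subtype.ext (funext fun v => ?_)
  have h : ∀ w ∈ block ends F' v,
      (∑ u ∈ block ends F w, x u) / ((block ends F w).card : ℂ) =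
        (∑ u ∈ block ends F v, x u) / ((block ends F v).card : ℂ) := by
    intro w hw
    rw [block_eq ends (hF _ _ ((mem_block ends).1 hw))]
  simp only [proj_coe, Finset.sum_sub_distrib]
  rw [Finset.sum_congr rfl h, Finset.sum_const, nsmul_eq_mul, sub_div,
    mul_div_cancel_left₀ _ (card_block_ne_zero ends F' v)]
  ring

theorem stdMap_self (F : Finset E) : stdMap ends F F = LinearMap.id := by
  refine LinearMap.ext fun x => Subtype.ext (funext fun v => ?_)
  change (x : V → ℂ) v - (∑ w ∈ block ends F v, (x : V → ℂ) w) / (block ends F v).card = x.1 v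
  rw [x.2 v, zero_div, sub_zero]

theorem Refines.stdMap_equivariant {F F' : Finset E} (hF : Refines ends F' F)
    (σ : young ends F') :
    stdMap ends F F' ∘ₗ stdRep ends F ⟨σ, hF.young_le σ.2⟩ =
      stdRep ends F' σ ∘ₗ stdMap ends F F' := by
  refine LinearMap.ext fun x => Subtype.ext (funext fun v => ?_)
  have hσ : (σ : Equiv.Perm V)⁻¹ ∈ young ends F' := (σ⁻¹).2
  change (x : V → ℂ) ((σ : Equiv.Perm V)⁻¹ v) -
      (∑ w ∈ block ends F' v, (x : V → ℂ) ((σ : Equiv.Perm V)⁻¹ w)) / (block ends F' v).card =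
    (x : V → ℂ) ((σ : Equiv.Perm V)⁻¹ v) -
      (∑ w ∈ block ends F' ((σ : Equiv.Perm V)⁻¹ v), (x : V → ℂ) w) /
        (block ends F' ((σ : Equiv.Perm V)⁻¹ v)).card
  rw [sum_block_perm ends F' hσ, ← block_eq ends (hσ v)]

theorem Refines.extMap_equivariant {F F' : Finset E} (hF : Refines ends F' F) (j : ℕ)
    (σ : young ends F') (w : ⋀[ℂ]^j (stdSpace ends F)) :
    exteriorPower.map j (stdMap ends F F')
        (extRep (stdRep ends F) j ⟨σ, hF.young_le σ.2⟩ w) =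
      extRep (stdRep ends F') j σ (exteriorPower.map j (stdMap ends F F') w) := by
  rw [extRep_apply, extRep_apply, ← LinearMap.comp_apply, ← LinearMap.comp_apply,
    ← exteriorPower.map_comp, ← exteriorPower.map_comp, hF.stdMap_equivariant]

/-- The map `ℳ_F → ℳ_{F'}` induced by `𝒯_F → 𝒯_{F'}` when the components of `F'` refine those
of `F`. -/
def Refines.stateMap {F F' : Finset E} (hF : Refines ends F' F) (j : ℕ) :
    (stateRep ends F j).IntertwiningMap (stateRep ends F' j) :=
  coindMapOfLE hF.young_le (extRep (stdRep ends F) j) (extRep (stdRep ends F') j)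
    (exteriorPower.map j (stdMap ends F F')) (hF.extMap_equivariant j)

theorem Refines.stateMap_apply {F F' : Finset E} (hF : Refines ends F' F) (j : ℕ)
    (f : StateMod ends F j) (τ : Equiv.Perm V) :
    (hF.stateMap j f).1 τ = exteriorPower.map j (stdMap ends F F') (f.1 τ) := rfl

variable (ends)

open scoped Classical in
/-- The map `ℳ_F → ℳ_{F'}` induced by `𝒯_F → 𝒯_{F'}`, with value zero unless the components of
`F'` refine those of `F`. -/
def transfer (F F' : Finset E) (j : ℕ) : StateMod ends F j →ₗ[ℂ] StateMod ends F' j :=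
  if h : Refines ends F' F then (h.stateMap j).toLinearMap else 0

theorem transfer_stateRep (F F' : Finset E) (j : ℕ) (σ : Equiv.Perm V) (x : StateMod ends F j) :
    transfer ends F F' j (stateRep ends F j σ x) = stateRep ends F' j σ (transfer ends F F' j x) := by
  unfold transfer
  split_ifs with h
  · exact LinearMap.congr_fun ((h.stateMap j).isIntertwining' σ) x
  · rw [LinearMap.zero_apply, LinearMap.zero_apply, map_zero]

theorem transfer_of_subset {F F' : Finset E} (h : F' ⊆ F) (j : ℕ) :
    transfer ends F F' j = (edgeMap ends h j).toLinearMap :=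
  dif_pos (Refines.of_subset h)

theorem transfer_self (F : Finset E) (j : ℕ) (x : StateMod ends F j) :
    transfer ends F F j x = x := by
  rw [transfer, dif_pos (Refines.of_subset subset_rfl)]
  refine Subtype.ext (funext fun τ => ?_)
  refine (Refines.stateMap_apply _ j x τ).trans ?_
  rw [stdMap_self, exteriorPower.map_id, LinearMap.id_apply]

variable {ends}

/-- Functoriality along refinements. It covers per-edge maps and their inverses alike, so composites
that delete some edges and insert others can be compared by their end states alone. -/
theorem transfer_transfer {F F' F'' : Finset E} (h' : Refines ends F'' F') (h : Refines ends F' F)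
    (j : ℕ) (x : StateMod ends F j) :
    transfer ends F' F'' j (transfer ends F F' j x) = transfer ends F F'' j x := by
  rw [transfer, transfer, transfer, dif_pos h', dif_pos h, dif_pos (h'.trans h)]
  refine Subtype.ext (funext fun τ => ?_)
  refine (Refines.stateMap_apply _ j _ τ).trans ?_
  refine Eq.trans ?_ (Refines.stateMap_apply _ j _ τ).symm
  refine (congrArg _ (Refines.stateMap_apply _ j _ τ)).trans ?_
  rw [← LinearMap.comp_apply, ← exteriorPower.map_comp]
  congr 2
  exact LinearMap.ext fun x => h'.proj_proj _

/-- Two states with the same components have isomorphic modules. Applied to `F` and `F + e₃`, this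
makes the per-edge map that deletes `e₃` invertible. -/
theorem transfer_cancel {F F' : Finset E} (h : Refines ends F' F) (h' : Refines ends F F') (j : ℕ)
    (x : StateMod ends F j) : transfer ends F' F j (transfer ends F F' j x) = x := by
  rw [transfer_transfer h' h, transfer_self]

end Transfer

/-! ### Chains supported on spanning subgraphs: inclusions, retractions and intersections. -/

section Chains

variable {V E : Type*} [Fintype V] [LinearOrder E] (ends : E → Sym2 V)

/-- The inclusion of `(ℳ_F)_j` in `C_{i,j}`, with value zero if `F` is not a state with `i`
edges. -/
def place (S : Finset E) (i : ℕ) (F : Finset E) (j : ℕ) :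
    StateMod ends F j →ₗ[ℂ] ChainMod ends S i j :=
  if h : F ⊆ S ∧ F.card = i then summand ends F h j else 0

theorem place_of_state {S : Finset E} {i : ℕ} {F : Finset E} (h : F ⊆ S ∧ F.card = i) (j : ℕ) :
    place ends S i F j = summand ends F h j :=
  dif_pos h

theorem place_of_not_subset {S : Finset E} {i : ℕ} {F : Finset E} (h : ¬F ⊆ S) (j : ℕ) :
    place ends S i F j = 0 :=
  dif_neg fun h' => h h'.1

theorem chainRep_place (S : Finset E) (i : ℕ) (F : Finset E) (j : ℕ) (σ : Equiv.Perm V)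
    (x : StateMod ends F j) :
    chainRep ends S i j σ (place ends S i F j x) = place ends S i F j (stateRep ends F j σ x) := by
  unfold place
  split_ifs with h
  · exact chainRep_summand ends j σ F h x
  · rw [LinearMap.zero_apply, LinearMap.zero_apply, map_zero]

variable {ends} in
theorem chain_hom_ext {S : Finset E} {i j : ℕ} {M : Type*} [AddCommGroup M] [Module ℂ M]
    {f g : ChainMod ends S i j →ₗ[ℂ] M}
    (h : ∀ F, F ⊆ S → F.card = i → ∀ x,
      f (place ends S i F j x) = g (place ends S i F j x)) : f = g :=
  DirectSum.linearMap_ext ℂ fun F => LinearMap.ext fun x => by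
    have := h F.1 F.2.1 F.2.2 x
    rw [place_of_state ends F.2] at this
    exact this

/-- The linear map on `C_{i,j}` with given components. -/
def chainLift {S : Finset E} {i j : ℕ} {M : Type*} [AddCommGroup M] [Module ℂ M]
    (f : ∀ F : Finset E, StateMod ends F j →ₗ[ℂ] M) : ChainMod ends S i j →ₗ[ℂ] M :=
  DirectSum.toModule ℂ (State S i) M fun F => f F.1

theorem chainLift_place {S : Finset E} {i j : ℕ} {M : Type*} [AddCommGroup M] [Module ℂ M]
    (f : ∀ F : Finset E, StateMod ends F j →ₗ[ℂ] M) {F : Finset E} (hF : F ⊆ S)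
    (hi : F.card = i) (x : StateMod ends F j) :
    chainLift ends f (place ends S i F j x) = f F x := by
  rw [place_of_state ends ⟨hF, hi⟩, chainLift, summand, DirectSum.toModule_lof]

theorem diffLin_place {S : Finset E} {i : ℕ} {F : Finset E} (hF : F ⊆ S) (hi : F.card = i + 1)
    (j : ℕ) (x : StateMod ends F j) :
    diffLin ends S i j (place ends S (i + 1) F j x) =
      ∑ e ∈ F, edgeSign S F e • place ends S i (F.erase e) j (transfer ends F (F.erase e) j x) := by
  rw [place_of_state ends ⟨hF, hi⟩, diffLin_summand, ← Finset.sum_coe_sort F]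
  refine Finset.sum_congr rfl fun e _ => ?_
  rw [place_of_state ends (erase_state ⟨hF, hi⟩ e.2),
    transfer_of_subset ends (Finset.erase_subset _ _)]
  rfl

theorem inclLin_place {S S' : Finset E} (hS : S ⊆ S') {i : ℕ} {F : Finset E} (hF : F ⊆ S)
    (hi : F.card = i) (j : ℕ) (x : StateMod ends F j) :
    inclLin ends hS i j (place ends S i F j x) = inclSign S S' F • place ends S' i F j x := by
  rw [place_of_state ends ⟨hF, hi⟩, place_of_state ends ⟨hF.trans hS, hi⟩, inclLin_summand]

theorem inclSign_mul_self (S S' F : Finset E) : inclSign S S' F * inclSign S S' F = 1 := by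
  rw [inclSign, ← Finset.prod_mul_distrib]
  refine Finset.prod_eq_one fun e _ => ?_
  rw [← mul_pow]
  simp

/-- For each edge of `F` the exponents count later edges in `S' \ S` and in `S'' \ S'`, which are
disjoint with union `S'' \ S`. -/
theorem inclSign_trans {S S' S'' : Finset E} (h : S ⊆ S') (h' : S' ⊆ S'') (F : Finset E) :
    inclSign S S' F * inclSign S' S'' F = inclSign S S'' F := by
  simp only [inclSign]
  rw [← Finset.prod_mul_distrib]
  refine Finset.prod_congr rfl fun e _ => ?_
  rw [← pow_add, ← Finset.card_union_of_disjoint, ← Finset.filter_union, Finset.union_comm,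
    Finset.sdiff_union_sdiff_cancel h' h]
  refine Finset.disjoint_filter_filter ?_
  rw [Finset.disjoint_left]
  intro g hg hg'
  exact (Finset.mem_sdiff.1 hg').2 (Finset.mem_sdiff.1 hg).1

theorem inclLin_inclLin {S S' S'' : Finset E} (h : S ⊆ S') (h' : S' ⊆ S'') (i j : ℕ)
    (x : ChainMod ends S i j) :
    inclLin ends h' i j (inclLin ends h i j x) = inclLin ends (h.trans h') i j x := by
  revert x
  refine LinearMap.congr_fun (f := inclLin ends h' i j ∘ₗ inclLin ends h i j)
    (chain_hom_ext fun F hF hi x => ?_)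
  rw [LinearMap.comp_apply, inclLin_place ends h hF hi, map_smul,
    inclLin_place ends h' (hF.trans h) hi, inclLin_place ends _ hF hi, smul_smul,
    inclSign_trans h h']

/-- The projection `C_{i,j}(V, S') → C_{i,j}(V, S)` for `S ⊆ S'`, which is left inverse to the
inclusion and kills the summands of the states which are not contained in `S`. -/
def retrLin (S S' : Finset E) (i j : ℕ) : ChainMod ends S' i j →ₗ[ℂ] ChainMod ends S i j :=
  chainLift ends fun F => inclSign S S' F • place ends S i F j

theorem retrLin_place (S : Finset E) {S' : Finset E} {i : ℕ} {F : Finset E} (hF : F ⊆ S')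
    (hi : F.card = i) (j : ℕ) (x : StateMod ends F j) :
    retrLin ends S S' i j (place ends S' i F j x) = inclSign S S' F • place ends S i F j x := by
  rw [retrLin, chainLift_place ends _ hF hi, LinearMap.smul_apply]

/-- The retraction is in general not a chain map, since deleting an edge can turn a state outside
`S` into one inside. Linearity and equivariance are all that the connecting map needs from it. -/
theorem retrLin_equivariant (S S' : Finset E) (i j : ℕ) (σ : Equiv.Perm V)
    (x : ChainMod ends S' i j) :
    retrLin ends S S' i j (chainRep ends S' i j σ x) =
      chainRep ends S i j σ (retrLin ends S S' i j x) := by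
  revert x
  refine LinearMap.congr_fun (f := retrLin ends S S' i j ∘ₗ chainRep ends S' i j σ)
    (g := chainRep ends S i j σ ∘ₗ retrLin ends S S' i j) (chain_hom_ext fun F hF hi x => ?_)
  rw [LinearMap.comp_apply, LinearMap.comp_apply, chainRep_place, retrLin_place ends S hF hi,
    retrLin_place ends S hF hi, map_smul, chainRep_place]

theorem retrLin_inclLin {S S' : Finset E} (h : S ⊆ S') (i j : ℕ) (x : ChainMod ends S i j) :
    retrLin ends S S' i j (inclLin ends h i j x) = x := by
  revert x
  refine LinearMap.congr_fun (f := retrLin ends S S' i j ∘ₗ inclLin ends h i j)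
    (g := LinearMap.id) (chain_hom_ext fun F hF hi x => ?_)
  rw [LinearMap.comp_apply, inclLin_place ends h hF hi, map_smul,
    retrLin_place ends S (hF.trans h) hi, smul_smul, inclSign_mul_self, one_smul,
    LinearMap.id_apply]

theorem inclLin_injective {S S' : Finset E} (h : S ⊆ S') (i j : ℕ) :
    Function.Injective (inclLin ends h i j) :=
  Function.LeftInverse.injective (retrLin_inclLin ends h i j)

/-- The base change property of inclusions and projections. -/
theorem retrLin_inclLin_inter {A B S : Finset E} (hA : A ⊆ S) (hB : B ⊆ S) (i j : ℕ)
    (x : ChainMod ends B i j) :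
    retrLin ends A S i j (inclLin ends hB i j x) =
      inclLin ends Finset.inter_subset_left i j (retrLin ends (A ∩ B) B i j x) := by
  revert x
  refine LinearMap.congr_fun (f := retrLin ends A S i j ∘ₗ inclLin ends hB i j)
    (g := inclLin ends Finset.inter_subset_left i j ∘ₗ retrLin ends (A ∩ B) B i j)
    (chain_hom_ext fun F hF hi x => ?_)
  rw [LinearMap.comp_apply, LinearMap.comp_apply, inclLin_place ends hB hF hi, map_smul,
    retrLin_place ends A (hF.trans hB) hi, retrLin_place ends _ hF hi, map_smul]
  by_cases hFA : F ⊆ A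
  · rw [inclLin_place ends _ (Finset.subset_inter hFA hF) hi, smul_smul, smul_smul]
    congr 1
    -- Both ways around the square from `A ∩ B` to `S` carry the same total sign; since signs are
    -- their own inverses, the factors can be moved across.
    have h1 := inclSign_trans (Finset.inter_subset_left : A ∩ B ⊆ A) hA F
    have h2 := inclSign_trans (Finset.inter_subset_right : A ∩ B ⊆ B) hB F
    have h3 := inclSign_mul_self (A ∩ B) A F
    have h4 := inclSign_mul_self B S F
    have h5 := inclSign_mul_self A S F
    linear_combination (inclSign B S F * inclSign (A ∩ B) A F) * (h1 - h2) -
      inclSign B S F * inclSign A S F * h3 + inclSign (A ∩ B) B F * inclSign (A ∩ B) A F * h4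
  -- A state outside `A` is also outside `A ∩ B`, so both sides are zero.
  · rw [place_of_not_subset ends hFA,
      place_of_not_subset ends fun h => hFA (h.trans Finset.inter_subset_left)]
    simp

/-- This is the exactness of `C(A ∩ B) → C(A) ⊕ C(B) → C(G)` in the middle: a chain coming from both
subgraphs is supported on their common states. The witness is the retraction of `b`. -/
theorem exists_of_inclLin_eq {A B S : Finset E} (hA : A ⊆ S) (hB : B ⊆ S) {i j : ℕ}
    {a : ChainMod ends A i j} {b : ChainMod ends B i j}
    (h : inclLin ends hA i j a = inclLin ends hB i j b) :
    ∃ c : ChainMod ends (A ∩ B) i j, inclLin ends Finset.inter_subset_left i j c = a ∧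
      inclLin ends Finset.inter_subset_right i j c = b := by
  have h1 : inclLin ends Finset.inter_subset_left i j (retrLin ends (A ∩ B) B i j b) = a := by
    rw [← retrLin_inclLin_inter ends hA hB, ← h, retrLin_inclLin]
  refine ⟨_, h1, inclLin_injective ends hB i j ?_⟩
  rw [inclLin_inclLin, ← h, ← h1, inclLin_inclLin]

theorem diffLin_inclLin {S S' : Finset E} (hS : S ⊆ S') (i j : ℕ)
    (x : ChainMod ends S (i + 1) j) :
    diffLin ends S' i j (inclLin ends hS (i + 1) j x) =
      inclLin ends hS i j (diffLin ends S i j x) :=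
  (LinearMap.congr_fun (inclLin_diffLin ends hS i j) x).symm

theorem diffLin_diffLin_apply (S : Finset E) (i j : ℕ) (x : ChainMod ends S (i + 2) j) :
    diffLin ends S i j (diffLin ends S (i + 1) j x) = 0 :=
  LinearMap.congr_fun (diffLin_diffLin ends S i j) x

theorem diffLin_equivariant (S : Finset E) (i j : ℕ) (σ : Equiv.Perm V)
    (x : ChainMod ends S (i + 1) j) :
    diffLin ends S i j (chainRep ends S (i + 1) j σ x) =
      chainRep ends S i j σ (diffLin ends S i j x) :=
  LinearMap.congr_fun ((diff ends S i j).isIntertwining' σ) x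

theorem mem_cycles_of_inclLin {S S' : Finset E} (hS : S ⊆ S') (i j : ℕ)
    {x : ChainMod ends S i j} (hx : inclLin ends hS i j x ∈ cycles ends S' i j) :
    x ∈ cycles ends S i j := by
  cases i with
  | zero => exact Submodule.mem_top
  | succ i =>
    change diffLin ends S' i j (inclLin ends hS (i + 1) j x) = 0 at hx
    change diffLin ends S i j x = 0
    refine inclLin_injective ends hS i j ?_
    rw [← diffLin_inclLin, hx, map_zero]

end Chains

/-! ### The homotopy that inserts `e₃`, and the deformation into `C(A) + C(B)`. -/

section Homotopy

variable {V E : Type*} [Fintype V] [LinearOrder E] (ends : E → Sym2 V)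

theorem edgeSign_mul_self (S F : Finset E) (e : E) : edgeSign S F e * edgeSign S F e = 1 := by
  rw [edgeSign, ← mul_pow]
  simp

/-- Only edges strictly after `e` are counted, so the presence of `e` itself does not affect the
sign. Hence the sign used in `fillLin` is that of the edge from `F + e₃` to `F`. -/
theorem edgeSign_erase_self {S F : Finset E} {e : E} (heS : e ∈ S) (he : e ∈ F) :
    edgeSign S (F.erase e) e = edgeSign S F e := by
  rw [edgeSign_erase heS he, if_neg (lt_irrefl e)]

/-- The contracting homotopy which adds the edge `e₃` to the states which contain `e₁` and `e₂`
but not `e₃`. -/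
def fillLin (e₁ e₂ e₃ : E) (S : Finset E) (i j : ℕ) :
    ChainMod ends S i j →ₗ[ℂ] ChainMod ends S (i + 1) j :=
  chainLift ends fun F =>
    if e₁ ∈ F ∧ e₂ ∈ F ∧ e₃ ∉ F then
      edgeSign S F e₃ • (place ends S (i + 1) (insert e₃ F) j ∘ₗ transfer ends F (insert e₃ F) j)
    else 0

variable {e₁ e₂ e₃ : E}

theorem fillLin_place {S : Finset E} {i : ℕ} {F : Finset E} (hF : F ⊆ S) (hi : F.card = i)
    (h₁ : e₁ ∈ F) (h₂ : e₂ ∈ F) (h₃ : e₃ ∉ F) (j : ℕ) (x : StateMod ends F j) :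
    fillLin ends e₁ e₂ e₃ S i j (place ends S i F j x) =
      edgeSign S F e₃ • place ends S (i + 1) (insert e₃ F) j
        (transfer ends F (insert e₃ F) j x) := by
  rw [fillLin, chainLift_place ends _ hF hi, if_pos ⟨h₁, h₂, h₃⟩]
  rfl

theorem fillLin_place_eq_zero {S : Finset E} {i : ℕ} {F : Finset E} (hF : F ⊆ S)
    (hi : F.card = i) (h : ¬(e₁ ∈ F ∧ e₂ ∈ F ∧ e₃ ∉ F)) (j : ℕ) (x : StateMod ends F j) :
    fillLin ends e₁ e₂ e₃ S i j (place ends S i F j x) = 0 := by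
  rw [fillLin, chainLift_place ends _ hF hi, if_neg h, LinearMap.zero_apply]

theorem fillLin_equivariant (S : Finset E) (i j : ℕ) (σ : Equiv.Perm V)
    (x : ChainMod ends S i j) :
    fillLin ends e₁ e₂ e₃ S i j (chainRep ends S i j σ x) =
      chainRep ends S (i + 1) j σ (fillLin ends e₁ e₂ e₃ S i j x) := by
  revert x
  refine LinearMap.congr_fun (f := fillLin ends e₁ e₂ e₃ S i j ∘ₗ chainRep ends S i j σ)
    (g := chainRep ends S (i + 1) j σ ∘ₗ fillLin ends e₁ e₂ e₃ S i j)
    (chain_hom_ext fun F hF hi x => ?_)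
  rw [LinearMap.comp_apply, LinearMap.comp_apply, chainRep_place]
  by_cases h : e₁ ∈ F ∧ e₂ ∈ F ∧ e₃ ∉ F
  · rw [fillLin_place ends hF hi h.1 h.2.1 h.2.2, fillLin_place ends hF hi h.1 h.2.1 h.2.2,
      map_smul, chainRep_place, transfer_stateRep]
  · rw [fillLin_place_eq_zero ends hF hi h, fillLin_place_eq_zero ends hF hi h, map_zero]

theorem fillLin_inclLin {S T : Finset E} (hS : T ⊆ S) (hT : ¬(e₁ ∈ T ∧ e₂ ∈ T)) (i j : ℕ)
    (x : ChainMod ends T i j) :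
    fillLin ends e₁ e₂ e₃ S i j (inclLin ends hS i j x) = 0 := by
  revert x
  refine LinearMap.congr_fun (f := fillLin ends e₁ e₂ e₃ S i j ∘ₗ inclLin ends hS i j)
    (g := 0) (chain_hom_ext fun F hF hi x => ?_)
  rw [LinearMap.comp_apply, inclLin_place ends hS hF hi, map_smul,
    fillLin_place_eq_zero ends (hF.trans hS) hi fun h => hT ⟨hF h.1, hF h.2.1⟩, smul_zero,
    LinearMap.zero_apply]

/-- The chain map `1 - d h - h d`, where `h` is the homotopy `fillLin`, in positive degrees. -/
def pushLin (e₁ e₂ e₃ : E) (S : Finset E) (i j : ℕ) :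
    ChainMod ends S (i + 1) j →ₗ[ℂ] ChainMod ends S (i + 1) j :=
  LinearMap.id - diffLin ends S (i + 1) j ∘ₗ fillLin ends e₁ e₂ e₃ S (i + 1) j -
    fillLin ends e₁ e₂ e₃ S i j ∘ₗ diffLin ends S i j

theorem pushLin_apply (S : Finset E) (i j : ℕ) (x : ChainMod ends S (i + 1) j) :
    pushLin ends e₁ e₂ e₃ S i j x =
      x - diffLin ends S (i + 1) j (fillLin ends e₁ e₂ e₃ S (i + 1) j x) -
        fillLin ends e₁ e₂ e₃ S i j (diffLin ends S i j x) :=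
  rfl

theorem pushLin_equivariant (S : Finset E) (i j : ℕ) (σ : Equiv.Perm V)
    (x : ChainMod ends S (i + 1) j) :
    pushLin ends e₁ e₂ e₃ S i j (chainRep ends S (i + 1) j σ x) =
      chainRep ends S (i + 1) j σ (pushLin ends e₁ e₂ e₃ S i j x) := by
  rw [pushLin_apply, pushLin_apply, map_sub, map_sub, fillLin_equivariant, diffLin_equivariant,
    diffLin_equivariant, fillLin_equivariant]

/-- This is the commutation `dp = pd`, with the right side written as `d - dhd` so that it also
makes sense when `d` lands in degree zero, where `p` is not defined. -/
theorem diffLin_pushLin (S : Finset E) (i j : ℕ) (x : ChainMod ends S (i + 1) j) :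
    diffLin ends S i j (pushLin ends e₁ e₂ e₃ S i j x) =
      diffLin ends S i j x -
        diffLin ends S i j (fillLin ends e₁ e₂ e₃ S i j (diffLin ends S i j x)) := by
  rw [pushLin_apply, map_sub, map_sub, diffLin_diffLin_apply, sub_zero]

theorem pushLin_inclLin {S T : Finset E} (hS : T ⊆ S) (hT : ¬(e₁ ∈ T ∧ e₂ ∈ T)) (i j : ℕ)
    (x : ChainMod ends T (i + 1) j) :
    pushLin ends e₁ e₂ e₃ S i j (inclLin ends hS (i + 1) j x) = inclLin ends hS (i + 1) j x := by
  rw [pushLin_apply, fillLin_inclLin ends hS hT, diffLin_inclLin, fillLin_inclLin ends hS hT,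
    map_zero, sub_zero, sub_zero]

theorem place_mem_range_inclLin {S T : Finset E} (hS : T ⊆ S) {i : ℕ} {F : Finset E} (hF : F ⊆ T)
    (hi : F.card = i) (j : ℕ) (x : StateMod ends F j) :
    place ends S i F j x ∈ LinearMap.range (inclLin ends hS i j) := by
  refine ⟨inclSign T S F • place ends T i F j x, ?_⟩
  rw [map_smul, inclLin_place ends hS hF hi, smul_smul, inclSign_mul_self, one_smul]

/-- The chains of the graph which are sums of a chain of `G - e₁` and a chain of `G - e₂`. -/
def sumChains (e₁ e₂ : E) (S : Finset E) (i j : ℕ) : Submodule ℂ (ChainMod ends S i j) :=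
  LinearMap.range (inclLin ends (S.erase_subset e₁) i j) ⊔
    LinearMap.range (inclLin ends (S.erase_subset e₂) i j)

theorem place_mem_sumChains {S : Finset E} {i : ℕ} {F : Finset E} (hF : F ⊆ S) (hi : F.card = i)
    (h : ¬(e₁ ∈ F ∧ e₂ ∈ F)) (j : ℕ) (x : StateMod ends F j) :
    place ends S i F j x ∈ sumChains ends e₁ e₂ S i j := by
  by_cases h₁ : e₁ ∈ F
  · refine Submodule.mem_sup_right (place_mem_range_inclLin ends _ ?_ hi j x)
    exact Finset.subset_erase.2 ⟨hF, fun h₂ => h ⟨h₁, h₂⟩⟩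
  · refine Submodule.mem_sup_left (place_mem_range_inclLin ends _ ?_ hi j x)
    exact Finset.subset_erase.2 ⟨hF, h₁⟩

/-- The map `1 - d h - h d` takes values in the sum of the chains of `G - e₁` and `G - e₂`, if
adding `e₃` to a state which contains `e₁` and `e₂` does not change its components. -/
theorem pushLin_mem_sumChains {S : Finset E} (h₃ : e₃ ∈ S) (h₁₃ : e₁ ≠ e₃) (h₂₃ : e₂ ≠ e₃)
    (hfill : ∀ F : Finset E, e₁ ∈ F → e₂ ∈ F → Refines ends (insert e₃ F) F) (i j : ℕ)
    (x : ChainMod ends S (i + 1) j) :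
    pushLin ends e₁ e₂ e₃ S i j x ∈ sumChains ends e₁ e₂ S (i + 1) j := by
  -- Passing to the quotient turns membership into the vanishing of a linear map, which can be
  -- tested on single summands.
  rw [← Submodule.Quotient.mk_eq_zero]
  revert x
  refine LinearMap.congr_fun
    (f := (sumChains ends e₁ e₂ S (i + 1) j).mkQ ∘ₗ pushLin ends e₁ e₂ e₃ S i j) (g := 0)
    (chain_hom_ext fun F hF hi x => ?_)
  rw [LinearMap.comp_apply, LinearMap.zero_apply, Submodule.mkQ_apply,
    Submodule.Quotient.mk_eq_zero, pushLin_apply]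
  have hFe : ∀ e ∈ F, F.erase e ⊆ S ∧ (F.erase e).card = i := fun e he => erase_state ⟨hF, hi⟩ he
  by_cases h : e₁ ∈ F ∧ e₂ ∈ F
  swap
  -- If `F` misses `e₁` or `e₂`, so does every `F - e`; then `h` kills both `x` and `dx`, and `p`
  -- fixes `x`.
  · rw [fillLin_place_eq_zero ends hF hi (fun h' => h ⟨h'.1, h'.2.1⟩), map_zero, sub_zero,
      diffLin_place ends hF hi, map_sum, Finset.sum_eq_zero, sub_zero]
    · exact place_mem_sumChains ends hF hi h j x
    · intro e he
      rw [map_smul, fillLin_place_eq_zero ends (hFe e he).1 (hFe e he).2, smul_zero]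
      exact fun h' => h ⟨Finset.mem_of_mem_erase h'.1, Finset.mem_of_mem_erase h'.2.1⟩
  obtain ⟨h₁, h₂⟩ := h
  by_cases h₃F : e₃ ∈ F
  -- If `F` contains all three edges, then `hx = 0`, and in `dx` only the term `F - e₃` can be
  -- refilled. Refilling it returns `x`, so `p x = 0`.
  · rw [fillLin_place_eq_zero ends hF hi (fun h' => h'.2.2 h₃F), map_zero, sub_zero,
      diffLin_place ends hF hi, map_sum, Finset.sum_eq_single_of_mem e₃ h₃F]
    · have he₁ : e₁ ∈ F.erase e₃ := Finset.mem_erase.2 ⟨h₁₃, h₁⟩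
      have he₂ : e₂ ∈ F.erase e₃ := Finset.mem_erase.2 ⟨h₂₃, h₂⟩
      have hr := hfill _ he₁ he₂
      rw [map_smul, fillLin_place ends (hFe e₃ h₃F).1 (hFe e₃ h₃F).2 he₁ he₂
        (Finset.notMem_erase _ _), edgeSign_erase_self h₃ h₃F, smul_smul, edgeSign_mul_self,
        one_smul]
      rw [Finset.insert_erase h₃F] at hr ⊢
      rw [transfer_cancel (Refines.of_subset (Finset.erase_subset _ _)) hr, sub_self]
      exact Submodule.zero_mem _
    · intro e he hne
      rw [map_smul, fillLin_place_eq_zero ends (hFe e he).1 (hFe e he).2, smul_zero]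
      exact fun h' => h'.2.2 (Finset.mem_erase.2 ⟨hne.symm, h₃F⟩)
  -- If only `e₃` is missing, the term of `dhx` that deletes `e₃` again is `x` itself. What remains
  -- is minus a sum over `e ∈ F`, which is treated term by term.
  · have hF' : insert e₃ F ⊆ S := Finset.insert_subset h₃ hF
    have hi' : (insert e₃ F).card = i + 1 + 1 := by rw [Finset.card_insert_of_notMem h₃F, hi]
    have hr : Refines ends (insert e₃ F) F := hfill F h₁ h₂
    have hs : edgeSign S (insert e₃ F) e₃ = edgeSign S F e₃ := by
      rw [← edgeSign_erase_self h₃ (Finset.mem_insert_self e₃ F), Finset.erase_insert h₃F]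
    have h0 : place ends S (i + 1) ((insert e₃ F).erase e₃) j
        (transfer ends (insert e₃ F) ((insert e₃ F).erase e₃) j
          (transfer ends F (insert e₃ F) j x)) = place ends S (i + 1) F j x := by
      rw [Finset.erase_insert h₃F,
        transfer_cancel hr (Refines.of_subset (Finset.subset_insert _ _))]
    rw [fillLin_place ends hF hi h₁ h₂ h₃F, map_smul, diffLin_place ends hF' hi',
      diffLin_place ends hF hi, Finset.sum_insert h₃F, h0, hs, smul_add, smul_smul,
      edgeSign_mul_self, one_smul, sub_add_cancel_left, map_sum, Finset.smul_sum, ← neg_add',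
      ← Finset.sum_add_distrib]
    refine Submodule.neg_mem _ (Submodule.sum_mem _ fun e he => ?_)
    have hne : e ≠ e₃ := fun h' => h₃F (h' ▸ he)
    have he' : (insert e₃ F).erase e ⊆ S ∧ ((insert e₃ F).erase e).card = i + 1 :=
      erase_state ⟨hF', hi'⟩ (Finset.mem_insert_of_mem he)
    rw [map_smul, transfer_transfer (Refines.of_subset (Finset.erase_subset _ _)) hr]
    -- If `e` is neither `e₁` nor `e₂`, inserting `e₃` and deleting `e` lead to the same state in
    -- either order, with opposite signs. Otherwise the `hd` term is zero and the `dh` term misses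
    -- `e₁` or `e₂`.
    by_cases hee : e₁ ∈ F.erase e ∧ e₂ ∈ F.erase e
    · have h3e : e₃ ∉ F.erase e := fun h' => h₃F (Finset.mem_of_mem_erase h')
      have hsq := edgeSign_square hF' (Finset.mem_insert_self e₃ F) (Finset.mem_insert_of_mem he)
        hne.symm
      have heq : insert e₃ (F.erase e) = (insert e₃ F).erase e :=
        (Finset.erase_insert_of_ne hne.symm).symm
      have hs' : edgeSign S ((insert e₃ F).erase e) e₃ = edgeSign S (F.erase e) e₃ := by
        rw [← heq, ← edgeSign_erase_self h₃ (Finset.mem_insert_self e₃ _),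
          Finset.erase_insert h3e]
      rw [Finset.erase_insert h₃F, hs, hs'] at hsq
      rw [fillLin_place ends (hFe e he).1 (hFe e he).2 hee.1 hee.2 h3e,
        transfer_transfer (hfill _ hee.1 hee.2) (Refines.of_subset (Finset.erase_subset _ _)),
        heq, smul_smul, smul_smul, ← add_smul]
      have h1 := edgeSign_mul_self S F e₃
      have h2 := edgeSign_mul_self S (F.erase e) e₃
      -- This is the sign rule `hsq` for the square that deletes `e` and `e₃` from `F + e₃`,
      -- multiplied by the two signs of `e₃`.
      have h3 : edgeSign S F e₃ * edgeSign S (insert e₃ F) e +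
          edgeSign S F e * edgeSign S (F.erase e) e₃ = 0 := by
        linear_combination (edgeSign S F e₃ * edgeSign S (F.erase e) e₃) * hsq -
          edgeSign S F e * edgeSign S (F.erase e) e₃ * h1 -
          edgeSign S F e₃ * edgeSign S (insert e₃ F) e * h2
      rw [h3, zero_smul]
      exact Submodule.zero_mem _
    · rw [fillLin_place_eq_zero ends (hFe e he).1 (hFe e he).2 fun h' => hee ⟨h'.1, h'.2.1⟩,
        smul_zero, add_zero]
      refine Submodule.smul_mem _ _ (Submodule.smul_mem _ _ ?_)
      refine place_mem_sumChains ends he'.1 he'.2 (fun h' => hee ⟨?_, ?_⟩) j _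
      · exact Finset.mem_erase.2 ⟨(Finset.mem_erase.1 h'.1).1, h₁⟩
      · exact Finset.mem_erase.2 ⟨(Finset.mem_erase.1 h'.2).1, h₂⟩

end Homotopy

/-! ### The condition on `e₃` supplied by a triangle. -/

section Closing

variable {V E : Type*} [LinearOrder E] (ends : E → Sym2 V)

/-- The edge `e₃` of the graph with edge set `S` is different from `e₁` and `e₂`, and adding it to
a state which contains `e₁` and `e₂` does not change the components. -/
structure Closes (S : Finset E) (e₁ e₂ e₃ : E) : Prop where
  mem : e₃ ∈ S
  ne₁ : e₁ ≠ e₃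
  ne₂ : e₂ ≠ e₃
  refines : ∀ F : Finset E, e₁ ∈ F → e₂ ∈ F → Refines ends (insert e₃ F) F

variable {ends} in
-- The path `u, v, w` through `e₁` and `e₂` joins the ends of `e₃`. The rest of the argument uses
-- the triangle only through this consequence.
theorem closes_of_triangle {S : Finset E} {e₁ e₂ e₃ : E} (h₃ : e₃ ∈ S) {u v w : V} (huv : u ≠ v)
    (hvw : v ≠ w) (huw : u ≠ w) (h1 : ends e₁ = s(u, v)) (h2 : ends e₂ = s(v, w))
    (h3 : ends e₃ = s(u, w)) : Closes ends S e₁ e₂ e₃ where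
  mem := h₃
  ne₁ := by
    rintro rfl
    rw [h1, Sym2.eq_iff] at h3
    rcases h3 with ⟨_, h⟩ | ⟨h, _⟩
    · exact hvw h
    · exact huw h
  ne₂ := by
    rintro rfl
    rw [h2, Sym2.eq_iff] at h3
    rcases h3 with ⟨h, _⟩ | ⟨h, _⟩
    · exact huv h.symm
    · exact hvw h
  refines F hF₁ hF₂ := refines_insert h3 ((conn_of_mem hF₁ h1 huv).trans (conn_of_mem hF₂ h2 hvw))

end Closing

/-! ### The connecting map. -/

section Snake

variable {V E : Type*} [Fintype V] [LinearOrder E] (ends : E → Sym2 V)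

/-- The connecting map on chains: the boundary of the part of `x - d h x - h d x` in the chains of
`G - e₁`. -/
def snakeLin (e₁ e₂ e₃ : E) (S : Finset E) (i j : ℕ) :
    ChainMod ends S (i + 1) j →ₗ[ℂ] ChainMod ends (S.erase e₁ ∩ S.erase e₂) i j :=
  retrLin ends (S.erase e₁ ∩ S.erase e₂) S i j ∘ₗ diffLin ends S i j ∘ₗ
    inclLin ends (S.erase_subset e₁) (i + 1) j ∘ₗ retrLin ends (S.erase e₁) S (i + 1) j ∘ₗ
      pushLin ends e₁ e₂ e₃ S i j

/-- Every factor commutes with the action, including the retraction that selects the `A`-part, so no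
non-canonical lift is involved. -/
theorem snakeLin_equivariant (e₁ e₂ e₃ : E) (S : Finset E) (i j : ℕ) (σ : Equiv.Perm V)
    (x : ChainMod ends S (i + 1) j) :
    snakeLin ends e₁ e₂ e₃ S i j (chainRep ends S (i + 1) j σ x) =
      chainRep ends (S.erase e₁ ∩ S.erase e₂) i j σ (snakeLin ends e₁ e₂ e₃ S i j x) := by
  have h := fun y => LinearMap.congr_fun
    (inclLin_equivariant ends (S.erase_subset e₁) (i + 1) j σ) y
  simp only [LinearMap.comp_apply] at h
  simp only [snakeLin, LinearMap.comp_apply]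
  rw [pushLin_equivariant, retrLin_equivariant, h, diffLin_equivariant, retrLin_equivariant]

variable {ends} {e₁ e₂ e₃ : E} {S : Finset E} (hc : Closes ends S e₁ e₂ e₃) {i j : ℕ}

theorem diffLin_pushLin_of_mem_cycles {x : ChainMod ends S (i + 1) j}
    (hx : x ∈ cycles ends S (i + 1) j) :
    diffLin ends S i j (pushLin ends e₁ e₂ e₃ S i j x) = 0 := by
  change diffLin ends S i j x = 0 at hx
  rw [diffLin_pushLin, hx, map_zero, map_zero, sub_zero]

theorem sub_pushLin_mem_boundaries {x : ChainMod ends S (i + 1) j}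
    (hx : x ∈ cycles ends S (i + 1) j) :
    x - pushLin ends e₁ e₂ e₃ S i j x ∈ boundaries ends S (i + 1) j := by
  change diffLin ends S i j x = 0 at hx
  refine ⟨fillLin ends e₁ e₂ e₃ S (i + 1) j x, ?_⟩
  rw [pushLin_apply, hx, map_zero, sub_zero, sub_sub_cancel]

include hc in
theorem Closes.exists_pushLin_eq (x : ChainMod ends S (i + 1) j) :
    ∃ a b, pushLin ends e₁ e₂ e₃ S i j x =
      inclLin ends (S.erase_subset e₁) (i + 1) j a +
        inclLin ends (S.erase_subset e₂) (i + 1) j b := by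
  obtain ⟨_, ⟨a, rfl⟩, _, ⟨b, rfl⟩, h⟩ := Submodule.mem_sup.1
    (pushLin_mem_sumChains ends hc.mem hc.ne₁ hc.ne₂ hc.refines i j x)
  exact ⟨a, b, h.symm⟩

include hc in
-- Since `d(p x) = 0`, the boundaries of the two parts of `p x` are opposite, so they lie in `C(A ∩
-- B)` and the last retraction in `snakeLin` loses nothing.
theorem Closes.snakeLin_spec {x : ChainMod ends S (i + 1) j} (hx : x ∈ cycles ends S (i + 1) j) :
    ∃ a b, pushLin ends e₁ e₂ e₃ S i j x =
        inclLin ends (S.erase_subset e₁) (i + 1) j a +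
          inclLin ends (S.erase_subset e₂) (i + 1) j b ∧
      diffLin ends _ i j a =
        inclLin ends Finset.inter_subset_left i j (snakeLin ends e₁ e₂ e₃ S i j x) ∧
      diffLin ends _ i j b =
        -inclLin ends Finset.inter_subset_right i j (snakeLin ends e₁ e₂ e₃ S i j x) := by
  obtain ⟨a₀, b₀, h₀⟩ := hc.exists_pushLin_eq x
  -- The part of `b₀` on states of `A ∩ B` is moved to the `A` side, so that `a` becomes the
  -- retraction of `p x` to `C(A)` used by `snakeLin`.
  set c := retrLin ends (S.erase e₁ ∩ S.erase e₂) (S.erase e₂) (i + 1) j b₀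
  set a := a₀ + inclLin ends Finset.inter_subset_left (i + 1) j c with ha
  set b := b₀ - inclLin ends Finset.inter_subset_right (i + 1) j c with hb
  have hab : pushLin ends e₁ e₂ e₃ S i j x =
      inclLin ends (S.erase_subset e₁) (i + 1) j a +
        inclLin ends (S.erase_subset e₂) (i + 1) j b := by
    rw [ha, hb, map_add, map_sub, inclLin_inclLin, inclLin_inclLin, h₀]
    abel
  have hra : retrLin ends (S.erase e₁) S (i + 1) j (pushLin ends e₁ e₂ e₃ S i j x) = a := by
    rw [h₀, map_add, retrLin_inclLin,
      retrLin_inclLin_inter ends (S.erase_subset e₁)]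
  have hd := diffLin_pushLin_of_mem_cycles (e₁ := e₁) (e₂ := e₂) (e₃ := e₃) hx
  rw [hab, map_add, diffLin_inclLin, diffLin_inclLin, ← eq_neg_iff_add_eq_zero, ← map_neg] at hd
  obtain ⟨z, hz₁, hz₂⟩ := exists_of_inclLin_eq ends _ _ hd
  have hz : snakeLin ends e₁ e₂ e₃ S i j x = z := by
    simp only [snakeLin, LinearMap.comp_apply]
    rw [hra, diffLin_inclLin, ← hz₁, inclLin_inclLin, retrLin_inclLin]
  refine ⟨a, b, hab, ?_, ?_⟩
  · rw [hz, hz₁]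
  · rw [hz, hz₂, neg_neg]

include hc in
-- Two decompositions of `p x` differ by a chain `c` of `A ∩ B`, so the resulting boundaries differ
-- by `dc`. This permits evaluating `δ` on any convenient decomposition.
theorem Closes.snakeLin_unique {x : ChainMod ends S (i + 1) j} (hx : x ∈ cycles ends S (i + 1) j)
    {a : ChainMod ends (S.erase e₁) (i + 1) j} {b : ChainMod ends (S.erase e₂) (i + 1) j}
    {z : ChainMod ends (S.erase e₁ ∩ S.erase e₂) i j}
    (hab : pushLin ends e₁ e₂ e₃ S i j x =
      inclLin ends (S.erase_subset e₁) (i + 1) j a +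
        inclLin ends (S.erase_subset e₂) (i + 1) j b)
    (hz : diffLin ends _ i j a = inclLin ends Finset.inter_subset_left i j z) :
    snakeLin ends e₁ e₂ e₃ S i j x - z ∈ boundaries ends (S.erase e₁ ∩ S.erase e₂) i j := by
  obtain ⟨a', b', hab', ha', -⟩ := hc.snakeLin_spec hx
  have h : inclLin ends (S.erase_subset e₁) (i + 1) j (a' - a) =
      inclLin ends (S.erase_subset e₂) (i + 1) j (b - b') := by
    rw [map_sub, map_sub, sub_eq_sub_iff_add_eq_add]
    exact hab'.symm.trans (hab.trans (add_comm _ _))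
  obtain ⟨c, hc₁, -⟩ := exists_of_inclLin_eq ends _ _ h
  refine ⟨c, inclLin_injective ends Finset.inter_subset_left i j ?_⟩
  rw [← diffLin_inclLin, hc₁, map_sub, map_sub, ha', hz]

include hc in
theorem Closes.snakeLin_mem_cycles {x : ChainMod ends S (i + 1) j}
    (hx : x ∈ cycles ends S (i + 1) j) :
    snakeLin ends e₁ e₂ e₃ S i j x ∈ cycles ends (S.erase e₁ ∩ S.erase e₂) i j := by
  obtain ⟨a, b, -, ha, -⟩ := hc.snakeLin_spec hx
  refine mem_cycles_of_inclLin ends Finset.inter_subset_left i j ?_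
  rw [← ha]
  exact boundaries_le_cycles ends _ i j ⟨a, rfl⟩

include hc in
theorem Closes.snakeLin_mem_boundaries {x : ChainMod ends S (i + 1) j}
    (hx : x ∈ boundaries ends S (i + 1) j) :
    snakeLin ends e₁ e₂ e₃ S i j x ∈ boundaries ends (S.erase e₁ ∩ S.erase e₂) i j := by
  have hx' := boundaries_le_cycles ends _ _ _ hx
  obtain ⟨y, rfl⟩ := hx
  obtain ⟨a, b, hab⟩ := hc.exists_pushLin_eq y
  rw [← sub_zero (snakeLin ends e₁ e₂ e₃ S i j _)]
  -- Since `p(dy) = d(p y) = da + db`, the boundary of `y` has a decomposition into boundaries, for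
  -- which `z = 0`.
  refine hc.snakeLin_unique hx' (a := diffLin ends _ (i + 1) j a)
    (b := diffLin ends _ (i + 1) j b) ?_ ?_
  · rw [← diffLin_inclLin, ← diffLin_inclLin, ← map_add, ← hab, diffLin_pushLin, pushLin_apply,
      diffLin_diffLin_apply, map_zero, sub_zero]
  · rw [diffLin_diffLin_apply, map_zero]

variable (ends S i j) in
/-- The homology class of a cycle. -/
def homologyClass : cycles ends S i j →ₗ[ℂ] BiHomology ends S i j :=
  Submodule.mkQ ((boundaries ends S i j).submoduleOf (cycles ends S i j))

variable (ends S i j) in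
theorem homologyClass_surjective : Function.Surjective (homologyClass ends S i j) :=
  Submodule.mkQ_surjective _

theorem homologyClass_eq_zero {x : cycles ends S i j} :
    homologyClass ends S i j x = 0 ↔ x.1 ∈ boundaries ends S i j :=
  Submodule.Quotient.mk_eq_zero _

theorem homologyClass_eq {x y : cycles ends S i j} :
    homologyClass ends S i j x = homologyClass ends S i j y ↔
      x.1 - y.1 ∈ boundaries ends S i j := by
  rw [← sub_eq_zero, ← map_sub, homologyClass_eq_zero]
  rfl

theorem biHomologyMap_class {S' : Finset E} (hS : S ⊆ S') (x : cycles ends S i j) :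
    biHomologyMap ends hS i j (homologyClass ends S i j x) =
      homologyClass ends S' i j ⟨inclLin ends hS i j x, inclLin_cycles ends hS i j x x.2⟩ :=
  rfl

theorem biHomologyRep_class (σ : Equiv.Perm V) (x : cycles ends S i j) :
    biHomologyRep ends S i j σ (homologyClass ends S i j x) =
      homologyClass ends S i j ⟨chainRep ends S i j σ x, cycles_le_comap ends S i j σ x.2⟩ :=
  rfl

/-- The connecting map `H_{i+1,j}(G) → H_{i,j}(A ∩ B)` as a linear map. -/
def Closes.connectingLin (i j : ℕ) :
    BiHomology ends S (i + 1) j →ₗ[ℂ] BiHomology ends (S.erase e₁ ∩ S.erase e₂) i j :=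
  Submodule.mapQ _ _
    ((snakeLin ends e₁ e₂ e₃ S i j).restrict fun _ => hc.snakeLin_mem_cycles)
    fun _ => hc.snakeLin_mem_boundaries

theorem Closes.connectingLin_class (x : cycles ends S (i + 1) j) :
    hc.connectingLin i j (homologyClass ends S (i + 1) j x) =
      homologyClass ends _ i j ⟨snakeLin ends e₁ e₂ e₃ S i j x, hc.snakeLin_mem_cycles x.2⟩ :=
  rfl

/-- The connecting map `H_{i+1,j}(G) → H_{i,j}(A ∩ B)` of the Mayer–Vietoris sequence. -/
def Closes.connecting (i j : ℕ) :
    (biHomologyRep ends S (i + 1) j).IntertwiningMap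
      (biHomologyRep ends (S.erase e₁ ∩ S.erase e₂) i j) where
  toLinearMap := hc.connectingLin i j
  isIntertwining' σ := by
    refine LinearMap.ext fun x => ?_
    obtain ⟨x, rfl⟩ := homologyClass_surjective ends _ _ _ x
    rw [LinearMap.comp_apply, LinearMap.comp_apply, biHomologyRep_class, hc.connectingLin_class,
      hc.connectingLin_class, biHomologyRep_class]
    exact congrArg _ (Subtype.ext (snakeLin_equivariant ends e₁ e₂ e₃ S i j σ x))

theorem Closes.connecting_class (x : cycles ends S (i + 1) j) :
    hc.connecting i j (homologyClass ends S (i + 1) j x) =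
      homologyClass ends _ i j ⟨snakeLin ends e₁ e₂ e₃ S i j x, hc.snakeLin_mem_cycles x.2⟩ :=
  hc.connectingLin_class x

end Snake

/-! ### Exactness in each fixed bidegree. -/

section Exactness

variable {V E : Type*} [Fintype V] [LinearOrder E] {ends : E → Sym2 V} {e₁ e₂ e₃ : E}
  {S : Finset E} (hc : Closes ends S e₁ e₂ e₃) {i j : ℕ}

theorem biHomologyMap_comp {T T' : Finset E} (hT : T ⊆ T') (hT' : T' ⊆ S)
    (x : BiHomology ends T i j) :
    biHomologyMap ends hT' i j (biHomologyMap ends hT i j x) =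
      biHomologyMap ends (hT.trans hT') i j x := by
  obtain ⟨x, rfl⟩ := homologyClass_surjective ends T i j x
  rw [biHomologyMap_class, biHomologyMap_class, biHomologyMap_class]
  exact congrArg _ (Subtype.ext (inclLin_inclLin ends hT hT' i j x.1))

include hc in
theorem Closes.exact_sum (a : BiHomology ends (S.erase e₁) i j)
    (b : BiHomology ends (S.erase e₂) i j)
    (h : biHomologyMap ends (S.erase_subset e₁) i j a +
      biHomologyMap ends (S.erase_subset e₂) i j b = 0) :
    ∃ z : BiHomology ends (S.erase e₁ ∩ S.erase e₂) i j,
      biHomologyMap ends Finset.inter_subset_left i j z = a ∧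
        -biHomologyMap ends Finset.inter_subset_right i j z = b := by
  obtain ⟨⟨a, ha⟩, rfl⟩ := homologyClass_surjective ends _ i j a
  obtain ⟨⟨b, hb⟩, rfl⟩ := homologyClass_surjective ends _ i j b
  rw [biHomologyMap_class, biHomologyMap_class, ← map_add, homologyClass_eq_zero] at h
  obtain ⟨y, hy⟩ := h
  change diffLin ends S i j y = inclLin ends (S.erase_subset e₁) i j a +
    inclLin ends (S.erase_subset e₂) i j b at hy
  -- Replacing `y` by `p y` keeps its boundary, because `h` vanishes on `dy = a + b`. Hence `a - da'
  -- = db' - b`, and this common chain on `A ∩ B` represents the required class.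
  obtain ⟨a', b', hab⟩ := hc.exists_pushLin_eq y
  have hd := congrArg (diffLin ends S i j) hab
  rw [diffLin_pushLin, hy, map_add, fillLin_inclLin ends _ (fun h => Finset.notMem_erase _ _ h.1),
    fillLin_inclLin ends _ (fun h => Finset.notMem_erase _ _ h.2), add_zero, map_zero, sub_zero,
    map_add, diffLin_inclLin, diffLin_inclLin, add_comm (inclLin ends _ i j (diffLin ends _ i j a')),
    ← sub_eq_sub_iff_add_eq_add, ← map_sub, ← map_sub] at hd
  obtain ⟨z, hz₁, hz₂⟩ := exists_of_inclLin_eq ends _ _ hd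
  have hz : z ∈ cycles ends _ i j := by
    refine mem_cycles_of_inclLin ends Finset.inter_subset_left i j ?_
    rw [hz₁]
    exact Submodule.sub_mem _ ha (boundaries_le_cycles ends _ i j ⟨a', rfl⟩)
  refine ⟨homologyClass ends _ i j ⟨z, hz⟩, ?_, ?_⟩
  · rw [biHomologyMap_class, homologyClass_eq]
    refine ⟨-a', ?_⟩
    dsimp only
    rw [hz₁, map_neg]
    abel
  · rw [biHomologyMap_class, ← map_neg, homologyClass_eq]
    refine ⟨-b', ?_⟩
    change _ = -inclLin ends Finset.inter_subset_right i j z - b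
    rw [hz₂, map_neg]
    abel

/-- As `p` fixes chains of `A`, the decomposition `a + 0` is available, and `da = 0`. -/
theorem Closes.connecting_inclLeft (a : BiHomology ends (S.erase e₁) (i + 1) j) :
    hc.connecting i j (biHomologyMap ends (S.erase_subset e₁) (i + 1) j a) = 0 := by
  obtain ⟨⟨a, ha⟩, rfl⟩ := homologyClass_surjective ends _ _ j a
  rw [biHomologyMap_class, hc.connecting_class, homologyClass_eq_zero]
  dsimp only
  rw [← sub_zero (snakeLin ends e₁ e₂ e₃ S i j _)]
  refine hc.snakeLin_unique (inclLin_cycles ends _ _ j a ha) (a := a) (b := 0) ?_ ?_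
  · rw [pushLin_inclLin ends _ (fun h => Finset.notMem_erase _ _ h.1), map_zero, add_zero]
  · rw [map_zero]
    exact ha

theorem Closes.connecting_inclRight (b : BiHomology ends (S.erase e₂) (i + 1) j) :
    hc.connecting i j (biHomologyMap ends (S.erase_subset e₂) (i + 1) j b) = 0 := by
  obtain ⟨⟨b, hb⟩, rfl⟩ := homologyClass_surjective ends _ _ j b
  rw [biHomologyMap_class, hc.connecting_class, homologyClass_eq_zero]
  dsimp only
  rw [← sub_zero (snakeLin ends e₁ e₂ e₃ S i j _)]
  refine hc.snakeLin_unique (inclLin_cycles ends _ _ j b hb) (a := 0) (b := b) ?_ ?_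
  · rw [pushLin_inclLin ends _ (fun h => Finset.notMem_erase _ _ h.2), map_zero, zero_add]
  · rw [map_zero, map_zero]

theorem Closes.exact_connecting (x : BiHomology ends S (i + 1) j) (h : hc.connecting i j x = 0) :
    ∃ (a : BiHomology ends (S.erase e₁) (i + 1) j) (b : BiHomology ends (S.erase e₂) (i + 1) j),
      biHomologyMap ends (S.erase_subset e₁) (i + 1) j a +
        biHomologyMap ends (S.erase_subset e₂) (i + 1) j b = x := by
  obtain ⟨⟨x, hx⟩, rfl⟩ := homologyClass_surjective ends _ _ j x
  rw [hc.connecting_class, homologyClass_eq_zero] at h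
  obtain ⟨w, hw⟩ := h
  obtain ⟨a, b, hab, ha, hb⟩ := hc.snakeLin_spec hx
  dsimp only at hw
  rw [← hw] at ha hb
  -- If `δ[x]` is the class of `dw`, shifting `w` from one part to the other turns both into cycles
  -- without changing their sum `p x`, which is homologous to `x`.
  have ha' : a - inclLin ends Finset.inter_subset_left (i + 1) j w ∈
      cycles ends (S.erase e₁) (i + 1) j := by
    change diffLin ends _ i j _ = 0
    rw [map_sub, ha, diffLin_inclLin, sub_self]
  have hb' : b + inclLin ends Finset.inter_subset_right (i + 1) j w ∈
      cycles ends (S.erase e₂) (i + 1) j := by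
    change diffLin ends _ i j _ = 0
    rw [map_add, hb, diffLin_inclLin, neg_add_cancel]
  refine ⟨homologyClass ends _ _ j ⟨_, ha'⟩, homologyClass ends _ _ j ⟨_, hb'⟩, ?_⟩
  rw [biHomologyMap_class, biHomologyMap_class, ← map_add, homologyClass_eq, ← neg_mem_iff,
    neg_sub]
  convert sub_pushLin_mem_boundaries (e₁ := e₁) (e₂ := e₂) (e₃ := e₃) hx using 2
  change inclLin ends _ (i + 1) j _ + inclLin ends _ (i + 1) j _ = _
  rw [hab, map_sub, map_add, inclLin_inclLin, inclLin_inclLin]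
  abel

theorem Closes.inclLeft_connecting (x : BiHomology ends S (i + 1) j) :
    biHomologyMap ends Finset.inter_subset_left i j (hc.connecting i j x) = 0 := by
  obtain ⟨⟨x, hx⟩, rfl⟩ := homologyClass_surjective ends _ _ j x
  obtain ⟨a, b, -, ha, -⟩ := hc.snakeLin_spec hx
  rw [hc.connecting_class, biHomologyMap_class, homologyClass_eq_zero]
  exact ⟨a, ha⟩

theorem Closes.inclRight_connecting (x : BiHomology ends S (i + 1) j) :
    biHomologyMap ends Finset.inter_subset_right i j (hc.connecting i j x) = 0 := by
  obtain ⟨⟨x, hx⟩, rfl⟩ := homologyClass_surjective ends _ _ j x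
  obtain ⟨a, b, -, -, hb⟩ := hc.snakeLin_spec hx
  rw [hc.connecting_class, biHomologyMap_class, homologyClass_eq_zero]
  refine ⟨-b, ?_⟩
  rw [map_neg, hb, neg_neg]

theorem Closes.exact_diff (z : BiHomology ends (S.erase e₁ ∩ S.erase e₂) i j)
    (h₁ : biHomologyMap ends Finset.inter_subset_left i j z = 0)
    (h₂ : biHomologyMap ends Finset.inter_subset_right i j z = 0) :
    ∃ x, hc.connecting i j x = z := by
  obtain ⟨⟨z, hz⟩, rfl⟩ := homologyClass_surjective ends _ _ j z
  rw [biHomologyMap_class, homologyClass_eq_zero] at h₁ h₂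
  obtain ⟨a, ha⟩ := h₁
  obtain ⟨b, hb⟩ := h₂
  -- When `z` bounds `a` in `A` and `b` in `B`, the difference `a - b` is a cycle of `G` whose
  -- `A`-part has boundary `z`.
  have hx : inclLin ends (S.erase_subset e₁) (i + 1) j a +
      inclLin ends (S.erase_subset e₂) (i + 1) j (-b) ∈ cycles ends S (i + 1) j := by
    change diffLin ends S i j _ = 0
    rw [map_add, diffLin_inclLin, diffLin_inclLin, ha, map_neg, hb, map_neg, inclLin_inclLin,
      inclLin_inclLin, add_neg_cancel]
  refine ⟨homologyClass ends _ _ j ⟨_, hx⟩, ?_⟩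
  rw [hc.connecting_class, homologyClass_eq]
  refine hc.snakeLin_unique hx (a := a) (b := -b) ?_ ha
  rw [map_add, pushLin_inclLin ends _ (fun h => Finset.notMem_erase _ _ h.1),
    pushLin_inclLin ends _ (fun h => Finset.notMem_erase _ _ h.2)]

/-- The only state without edges is the empty one, so every subgraph has the same chains in degree
zero. -/
theorem biHomologyMap_zero_surjective {T : Finset E} (hT : T ⊆ S) (j : ℕ) :
    Function.Surjective (biHomologyMap ends hT 0 j) := by
  intro x
  obtain ⟨⟨x, hx⟩, rfl⟩ := homologyClass_surjective ends _ _ j x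
  refine ⟨homologyClass ends T 0 j ⟨retrLin ends T S 0 j x, Submodule.mem_top⟩, ?_⟩
  rw [biHomologyMap_class]
  refine congrArg _ (Subtype.ext ?_)
  change inclLin ends hT 0 j (retrLin ends T S 0 j x) = x
  clear hx
  revert x
  refine LinearMap.congr_fun (f := inclLin ends hT 0 j ∘ₗ retrLin ends T S 0 j)
    (g := LinearMap.id) (chain_hom_ext fun F hF hi x => ?_)
  have hFT : F ⊆ T := by
    rw [Finset.card_eq_zero.1 hi]
    exact Finset.empty_subset T
  rw [LinearMap.comp_apply, retrLin_place ends T hF hi, map_smul, inclLin_place ends hT hFT hi,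
    smul_smul, inclSign_mul_self, one_smul, LinearMap.id_apply]

end Exactness

/-! ### Assembling the bidegrees into direct sums over `j`. -/

section Graded

/-- Elements of a direct sum can be chosen componentwise. -/
theorem exists_directSum {X : ℕ → Type*} [∀ j, AddCommGroup (X j)] (s : Finset ℕ)
    (P : ∀ j, X j → Prop) (h : ∀ j, ∃ x, P j x) (h0 : ∀ j ∉ s, P j 0) :
    ∃ x : ⨁ j, X j, ∀ j, P j (x j) := by
  choose f hf using h
  refine ⟨DirectSum.mk X s fun j => f j, fun j => ?_⟩
  by_cases hj : j ∈ s
  · rw [DirectSum.mk_apply_of_mem hj]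
    exact hf j
  · rw [DirectSum.mk_apply_of_notMem hj]
    exact h0 j hj

end Graded

section MayerVietoris

variable {V E : Type*} [Fintype V] [LinearOrder E] {ends : E → Sym2 V} {e₁ e₂ e₃ : E}
  {S : Finset E} (hc : Closes ends S e₁ e₂ e₃) {i : ℕ}

open scoped Classical in
theorem homology_eq_zero_of_notMem {T : Finset E} {x : Homology ends T i} {j : ℕ}
    (h : j ∉ DFinsupp.support x) : x j = 0 :=
  DFinsupp.notMem_support_iff.1 h

theorem mvPhi_fst {A B : Finset E} (x : Homology ends (A ∩ B) i) (j : ℕ) :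
    (mvPhi ends A B i x).1 j = biHomologyMap ends Finset.inter_subset_left i j (x j) :=
  rfl

theorem mvPhi_snd {A B : Finset E} (x : Homology ends (A ∩ B) i) (j : ℕ) :
    (mvPhi ends A B i x).2 j = -biHomologyMap ends Finset.inter_subset_right i j (x j) :=
  rfl

theorem mvPsi_apply {A B : Finset E} (hA : A ⊆ S) (hB : B ⊆ S)
    (x : Homology ends A i × Homology ends B i) (j : ℕ) :
    mvPsi ends hA hB i x j =
      biHomologyMap ends hA i j (x.1 j) + biHomologyMap ends hB i j (x.2 j) :=
  rfl

theorem gradedMap_connecting_apply (x : Homology ends S (i + 1)) (j : ℕ) :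
    gradedMap (hc.connecting i) x j = hc.connecting i j (x j) :=
  rfl

include hc in
theorem Closes.exact_mvPhi_mvPsi (i : ℕ) :
    Function.Exact (mvPhi ends (S.erase e₁) (S.erase e₂) i)
      (mvPsi ends (S.erase_subset e₁) (S.erase_subset e₂) i) := by
  classical
  rintro ⟨a, b⟩
  constructor
  · intro h
    have hj : ∀ j, biHomologyMap ends (S.erase_subset e₁) i j (a j) +
        biHomologyMap ends (S.erase_subset e₂) i j (b j) = 0 := fun j => by
      rw [← mvPsi_apply (S.erase_subset e₁) (S.erase_subset e₂) (a, b) j, h]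
      rfl
    obtain ⟨z, hz⟩ := exists_directSum (DFinsupp.support a ∪ DFinsupp.support b)
      (fun j z => biHomologyMap ends Finset.inter_subset_left i j z = a j ∧
        -biHomologyMap ends Finset.inter_subset_right i j z = b j)
      (fun j => hc.exact_sum (a j) (b j) (hj j)) (fun j hj => by
        rw [Finset.mem_union, not_or] at hj
        rw [homology_eq_zero_of_notMem hj.1, homology_eq_zero_of_notMem hj.2, map_zero, map_zero,
          neg_zero]
        exact ⟨rfl, rfl⟩)
    exact ⟨z, Prod.ext (DFinsupp.ext fun j => (hz j).1) (DFinsupp.ext fun j => (hz j).2)⟩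
  · rintro ⟨z, hz⟩
    refine DFinsupp.ext fun j => ?_
    rw [← hz, mvPsi_apply, mvPhi_fst, mvPhi_snd, map_neg, biHomologyMap_comp, biHomologyMap_comp,
      add_neg_cancel]
    rfl

theorem Closes.exact_mvPsi_connecting (i : ℕ) :
    Function.Exact (mvPsi ends (S.erase_subset e₁) (S.erase_subset e₂) (i + 1))
      (gradedMap (hc.connecting i)) := by
  classical
  intro x
  constructor
  · intro h
    have hj : ∀ j, hc.connecting i j (x j) = 0 := fun j => by
      rw [← gradedMap_connecting_apply, h]
      rfl
    choose a b hab using fun j => hc.exact_connecting (x j) (hj j)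
    -- The condition couples the two components, so they are chosen as one element of a direct sum
    -- of products, zero off the support of `x`, and separated afterwards.
    obtain ⟨z, hz⟩ := exists_directSum (X := fun j =>
      BiHomology ends (S.erase e₁) (i + 1) j × BiHomology ends (S.erase e₂) (i + 1) j)
      (DFinsupp.support x)
      (fun j z => biHomologyMap ends (S.erase_subset e₁) (i + 1) j z.1 +
        biHomologyMap ends (S.erase_subset e₂) (i + 1) j z.2 = x j)
      (fun j => ⟨(a j, b j), hab j⟩) (fun j hj => by
        rw [homology_eq_zero_of_notMem hj, Prod.fst_zero, Prod.snd_zero, map_zero, map_zero,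
          add_zero])
    refine ⟨(DirectSum.map (fun j => AddMonoidHom.fst _ _) z,
      DirectSum.map (fun j => AddMonoidHom.snd _ _) z), DFinsupp.ext fun j => ?_⟩
    rw [mvPsi_apply]
    exact hz j
  · rintro ⟨y, rfl⟩
    refine DFinsupp.ext fun j => ?_
    rw [gradedMap_connecting_apply, mvPsi_apply, map_add, hc.connecting_inclLeft,
      hc.connecting_inclRight, add_zero]
    rfl

theorem Closes.exact_connecting_mvPhi (i : ℕ) :
    Function.Exact (gradedMap (hc.connecting i))
      (mvPhi ends (S.erase e₁) (S.erase e₂) i) := by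
  classical
  intro z
  constructor
  · intro h
    have h₁ : ∀ j, biHomologyMap ends Finset.inter_subset_left i j (z j) = 0 := fun j => by
      rw [← mvPhi_fst, h]
      rfl
    have h₂ : ∀ j, biHomologyMap ends Finset.inter_subset_right i j (z j) = 0 := fun j => by
      rw [← neg_eq_zero, ← mvPhi_snd, h]
      rfl
    obtain ⟨x, hx⟩ := exists_directSum (DFinsupp.support z)
      (fun j x => hc.connecting i j x = z j) (fun j => hc.exact_diff (z j) (h₁ j) (h₂ j))
      (fun j hj => by rw [homology_eq_zero_of_notMem hj, map_zero])
    exact ⟨x, DFinsupp.ext hx⟩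
  · rintro ⟨x, rfl⟩
    refine Prod.ext (DFinsupp.ext fun j => ?_) (DFinsupp.ext fun j => ?_)
    · rw [mvPhi_fst, gradedMap_connecting_apply, hc.inclLeft_connecting]
      rfl
    · rw [mvPhi_snd, gradedMap_connecting_apply, hc.inclRight_connecting, neg_zero]
      rfl

theorem mvPsi_zero_surjective {A B : Finset E} (hA : A ⊆ S) (hB : B ⊆ S) :
    Function.Surjective (mvPsi ends hA hB 0) := by
  classical
  intro x
  obtain ⟨a, ha⟩ := exists_directSum (DFinsupp.support x)
    (fun j a => biHomologyMap ends hA 0 j a = x j)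
    (fun j => biHomologyMap_zero_surjective hA j (x j))
    (fun j hj => by rw [homology_eq_zero_of_notMem hj, map_zero])
  -- One of the two subgraphs already accounts for all of `H₀(G)`, so the other component may be
  -- zero.
  refine ⟨(a, 0), DFinsupp.ext fun j => ?_⟩
  rw [mvPsi_apply, ha j]
  exact (congrArg (x j + ·) (map_zero _)).trans (add_zero _)

end MayerVietoris

end ChromSymHom

end

theorem theorem4p4 {V E : Type*} [Fintype V] [LinearOrder E] (ends : E → Sym2 V) (S : Finset E)
    (e₁ e₂ e₃ : E) (he₁ : e₁ ∈ S) (he₂ : e₂ ∈ S) (he₃ : e₃ ∈ S)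
    (htri : ∃ u v w : V, u ≠ v ∧ v ≠ w ∧ u ≠ w ∧
      ends e₁ = s(u, v) ∧ ends e₂ = s(v, w) ∧ ends e₃ = s(u, w)) :
    ∃ δ : ∀ i j : ℕ, (ChromSymHom.biHomologyRep ends S (i + 1) j).IntertwiningMap
        (ChromSymHom.biHomologyRep ends (S.erase e₁ ∩ S.erase e₂) i j),
      (∀ i : ℕ,
        Function.Exact (ChromSymHom.mvPhi ends (S.erase e₁) (S.erase e₂) i)
          (ChromSymHom.mvPsi ends (S.erase_subset e₁) (S.erase_subset e₂) i) ∧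
        Function.Exact (ChromSymHom.mvPsi ends (S.erase_subset e₁) (S.erase_subset e₂) (i + 1))
          (ChromSymHom.gradedMap (δ i)) ∧
        Function.Exact (ChromSymHom.gradedMap (δ i))
          (ChromSymHom.mvPhi ends (S.erase e₁) (S.erase e₂) i)) ∧
      Function.Surjective
        (ChromSymHom.mvPsi ends (S.erase_subset e₁) (S.erase_subset e₂) 0) := by
  obtain ⟨u, v, w, huv, hvw, huw, h1, h2, h3⟩ := htri
  have hc := ChromSymHom.closes_of_triangle he₃ huv hvw huw h1 h2 h3
  exact ⟨hc.connecting, fun i => ⟨hc.exact_mvPhi_mvPsi i, hc.exact_mvPsi_connecting i,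
    hc.exact_connecting_mvPhi i⟩, ChromSymHom.mvPsi_zero_surjective _ _⟩
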